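/- Max algebra is the semiring of nonnegative reals with addition $a\oplus b=\max(a,b)$ and the usual multiplication; matrix sums, products and powers are taken in this semiring ($A^0=I$). For $A=(a_{ij})\in\mathbb{R}_+^{n\times n}$, an eigenvalue is an $\alpha\ge 0$ with $A\otimes v=\alpha v$ for some nonzero $v\in\mathbb{R}_+^n$. The associated digraph of $A$ has nodes $1,\dots,n$ and an edge $(i,j)$ whenever $a_{ij}>0$. The classes of $A$ are the (node sets of the) strongly connected components of this digraph, a single node always being regarded as strongly connected. The reduced digraph has the classes as nodes and an edge $(\mu,\nu)$ whenever $a_{ij}>0$ for some $i\in\mu$, $j\in\nu$. Write $\mu\to\nu$ if $\mu=\nu$ or there is a path from $\mu$ to $\nu$ in the reduced digraph; the transitive closure of the reduced digraph has the edges $(\mu,\nu)$ with $\mu\to\nu$. The Perron root $\alpha_\mu$ of a class $\mu$ is the maximal cycle geometric mean $$\alpha_\mu=\max_{1\le k\le |\mu|}\ \max_{i_1,\dots,i_k\in\mu}\ (a_{i_1i_2}a_{i_2i_3}\cdots a_{i_ki_1})^{1/k}.$$ A class $\nu$ is initial if $\mu\to\nu$ implies $\mu=\nu$; it is spectral if it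 is initial, or if $\alpha_\nu>0$ and $\mu\to\nu$ implies $\alpha_\mu\le\alpha_\nu$. A max polynomial $p(x_1,\dots,x_r)$ is a polynomial with nonnegative coefficients in which the sum is replaced by the maximum. Theorem. Let $r\ge 1$ and let $A_1,\dots,A_r\in\mathbb{R}_+^{n\times n}$ commute pairwise in max algebra. Suppose that, for each $i$, distinct classes of $A_i$ have distinct Perron roots. Then: (i) All classes of $A_1,\dots,A_r$ and of $A_1\oplus\cdots\oplus A_r$ coincide. (ii) The transitive closures of the reduced digraphs of $A_1,\dots,A_r$ and of $A_1\oplus\cdots\oplus A_r$ coincide. (iii) The spectral classes of $A_1,\dots,A_r$ and of $A_1\oplus\cdots\oplus A_r$ coincide. In particular, $A_1,\dots,A_r$ have the same (finite) number of distinct eigenvalues. (iv) Let $\mu_1,\dots,\mu_m$ be the common spectral classes of $A_1,\dots,A_r$ and let $\alpha_i^j$ be the Perron root of the class $\mu_j$ of $A_i$. Then, for every max polynomial $p(x_1,\dots,x_r)$, the set of eigenvalues of $p(A_1,\dots,A_r)$ is exactly $\{p(\alpha_1^j,\dots,\alpha_r^j) : j=1,\dots,m\}$ (possibly with repetitions among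 these values). -/

import Mathlib

open scoped NNReal

/-- The underlying set of max algebra: the nonnegative real numbers. It is a separate name for
`ℝ≥0` because it carries another addition. -/
def MaxAlg : Type := ℝ≥0

namespace MaxAlg

noncomputable section

instance : LinearOrder MaxAlg := inferInstanceAs (LinearOrder ℝ≥0)

/-- A scalar of max algebra, seen as a nonnegative real number. -/
def toNNReal : MaxAlg ≃ ℝ≥0 := Equiv.refl _

instance : Zero MaxAlg := ⟨toNNReal.symm 0⟩

instance : One MaxAlg := ⟨toNNReal.symm 1⟩

instance : Add MaxAlg := ⟨fun a b => toNNReal.symm (max (toNNReal a) (toNNReal b))⟩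

instance : Mul MaxAlg := ⟨fun a b => toNNReal.symm (toNNReal a * toNNReal b)⟩

/-- Max algebra: the semiring of nonnegative reals in which the sum of `a` and `b` is `max a b`,
the product is the usual product, and zero and one are the usual ones. -/
instance : CommSemiring MaxAlg where
  nsmul := nsmulRec
  add_assoc a b c := max_assoc (toNNReal a) (toNNReal b) (toNNReal c)
  add_comm a b := max_comm (toNNReal a) (toNNReal b)
  zero_add a := max_eq_right (bot_le : (⊥ : ℝ≥0) ≤ toNNReal a)
  add_zero a := max_eq_left (bot_le : (⊥ : ℝ≥0) ≤ toNNReal a)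
  mul_assoc a b c := mul_assoc (toNNReal a) (toNNReal b) (toNNReal c)
  mul_comm a b := mul_comm (toNNReal a) (toNNReal b)
  one_mul a := one_mul (toNNReal a)
  mul_one a := mul_one (toNNReal a)
  zero_mul a := zero_mul (toNNReal a)
  mul_zero a := mul_zero (toNNReal a)
  left_distrib a b c := mul_max (toNNReal a) (toNNReal b) (toNNReal c)
  right_distrib a b c := max_mul (toNNReal a) (toNNReal b) (toNNReal c)

theorem toNNReal_add (a b : MaxAlg) : toNNReal (a + b) = max (toNNReal a) (toNNReal b) := rfl

theorem toNNReal_mul (a b : MaxAlg) : toNNReal (a * b) = toNNReal a * toNNReal b := rfl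

theorem toNNReal_zero : toNNReal 0 = 0 := rfl

theorem toNNReal_one : toNNReal 1 = 1 := rfl

theorem toNNReal_le {a b : MaxAlg} : toNNReal a ≤ toNNReal b ↔ a ≤ b := Iff.rfl

theorem toNNReal_lt {a b : MaxAlg} : toNNReal a < toNNReal b ↔ a < b := Iff.rfl

variable {ι : Type*}

/-- The set of eigenvalues of `A` in max algebra. -/
def eigenvalues [Fintype ι] (A : Matrix ι ι MaxAlg) : Set MaxAlg :=
  {α | ∃ v : ι → MaxAlg, v ≠ 0 ∧ A.mulVec v = α • v}

/-- The maximal cycle geometric mean of `A`: the maximum, over `1 ≤ k ≤ n` (with `n` the size of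
`A`) and over all closed sequences `i₁, …, i_k, i₁` of nodes, of
`(a_{i₁ i₂} ⋯ a_{i_k i₁}) ^ (1 / k)`. -/
def maxCycleMean [Fintype ι] (A : Matrix ι ι MaxAlg) : MaxAlg :=
  toNNReal.symm <|
    (Finset.Icc 1 (Fintype.card ι)).sup fun k =>
      (Finset.univ : Finset (Fin k → ι)).sup fun s =>
        (∏ j : Fin k, toNNReal (A (s j) (s (finRotate k j)))) ^ (1 / (k : ℝ))

/-- `i` has access to `j` in the associated digraph of `A`, whose edges are the pairs `(i, j)`
with `0 < A i j`: there is a path, possibly of length zero, from `i` to `j`. -/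
def NodeAccess (A : Matrix ι ι MaxAlg) : ι → ι → Prop :=
  Relation.ReflTransGen fun i j => 0 < A i j

/-- The classes of `A`: the sets of nodes of the strongly connected components of the associated
digraph of `A`. -/
def classes (A : Matrix ι ι MaxAlg) : Set (Set ι) :=
  {S | ∃ i, S = {j | NodeAccess A i j ∧ NodeAccess A j i}}

/-- The edges of the reduced digraph of `A`, whose nodes are the classes of `A`. -/
def ReducedAdj (A : Matrix ι ι MaxAlg) (μ ν : Set ι) : Prop :=
  μ ∈ classes A ∧ ν ∈ classes A ∧ ∃ i ∈ μ, ∃ j ∈ ν, 0 < A i j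

/-- The edges of the transitive closure of the reduced digraph of `A`: the class `μ` has access to
the class `ν`, that is, `μ = ν` or there is a path from `μ` to `ν` in the reduced digraph. -/
def Access (A : Matrix ι ι MaxAlg) (μ ν : Set ι) : Prop :=
  μ ∈ classes A ∧ ν ∈ classes A ∧ Relation.ReflTransGen (ReducedAdj A) μ ν

open Classical in
/-- The Perron root of a class `μ`: the maximal cycle geometric mean of the submatrix of `A` with
rows and columns in `μ`. -/
def perronRoot [Fintype ι] (A : Matrix ι ι MaxAlg) (μ : Set ι) : MaxAlg :=
  maxCycleMean (A.submatrix (fun i : μ => (i : ι)) (fun i : μ => (i : ι)))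

/-- A class is initial if no other class has access to it. -/
def IsInitial (A : Matrix ι ι MaxAlg) (ν : Set ι) : Prop :=
  ν ∈ classes A ∧ ∀ μ, Access A μ ν → μ = ν

/-- A class `ν` is spectral if it is initial, or if its Perron root is positive and no class with
access to `ν` has a larger Perron root. -/
def IsSpectral [Fintype ι] (A : Matrix ι ι MaxAlg) (ν : Set ι) : Prop :=
  ν ∈ classes A ∧
    (IsInitial A ν ∨
      (0 < perronRoot A ν ∧ ∀ μ, Access A μ ν → perronRoot A μ ≤ perronRoot A ν))

/-- The value of the max polynomial `p` at the square matrices `A 0, …, A (r - 1)`; the factors of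
each monomial are multiplied in this order. A max polynomial is a polynomial with coefficients in
the semiring `MaxAlg`. -/
def evalMatrix [Fintype ι] [DecidableEq ι] {r : ℕ} (p : MvPolynomial (Fin r) MaxAlg)
    (A : Fin r → Matrix ι ι MaxAlg) : Matrix ι ι MaxAlg :=
  ∑ d ∈ p.support, p.coeff d • (List.ofFn fun i => A i ^ d i).prod

end

end MaxAlg

namespace MaxAlg

noncomputable section

/-! ### Order, topology and linear algebra over the max semiring. -/

section

/-! Everything rests on common eigenvectors. A nonzero closed subsemimodule invariant under a matrix
contains an eigenvector of it (`exists_eigenvector`); eigenspaces are closed and invariant under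
commuting matrices, so intersecting them one matrix at a time gives a common eigenvector
(`exists_common_eigenvector`).

The distinctness of the Perron roots enters twice. First, let `B` commute with `A` and suppose that
some edge of `B` joins nodes without access in `A`. For an extremal such edge from a class `μ` to a
class `ν`, the equation `A B = B A` restricts to the blocks: the block of `B` carries a Perron
vector of `ν` to a nonzero eigenvector of the block of `μ` with the root of `ν`. So the two roots
agree, hence `μ = ν`, which is absurd (`nodeAccess_of_commute`). By symmetry all matrices, and their
sum, have the same access relation; this is (i) and (ii).

Second, every node in the support of an eigenvector has access to a class in the support whose root
is the eigenvalue. There is only one class with that root, so the support has a single final class,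
and this class is spectral (`exists_final_node`, `isSpectral_of_eigenvector`). Conversely, a
spectral class carries an eigenvector supported on its predecessors
(`exists_eigenvector_of_isSpectral`). Choosing it common to all matrices makes the class spectral
for each of them and for the sum, which is the main step of (iii). For (iv), an eigenspace of `p(A₁,
…, A_r)` contains a common eigenvector; its final class is a common spectral class, and `p`
evaluated at the roots of that class is the eigenvalue. -/

instance : CommGroupWithZero MaxAlg :=
  { (inferInstance : CommMonoidWithZero MaxAlg) with
    inv := fun a => toNNReal.symm (toNNReal a)⁻¹
    exists_pair_ne := ⟨0, 1, fun h => zero_ne_one (α := ℝ≥0) h⟩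
    inv_zero := inv_zero (G₀ := ℝ≥0)
    mul_inv_cancel := fun a ha => mul_inv_cancel₀ (G₀ := ℝ≥0) ha }

instance : LinearOrderedCommGroupWithZero MaxAlg :=
  { (inferInstance : LinearOrder MaxAlg), (inferInstance : CommGroupWithZero MaxAlg) with
    bot := 0
    bot_le := fun a => (bot_le : (⊥ : ℝ≥0) ≤ toNNReal a)
    isBot_zero := fun a => (bot_le : (⊥ : ℝ≥0) ≤ toNNReal a)
    mul_lt_mul_of_pos_left := fun a (ha : 0 < toNNReal a) b c (h : toNNReal b < toNNReal c) =>
      (mul_lt_mul_of_pos_left h ha : toNNReal a * toNNReal b < toNNReal a * toNNReal c) }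

instance : TopologicalSpace MaxAlg := inferInstanceAs (TopologicalSpace ℝ≥0)

instance : OrderTopology MaxAlg := inferInstanceAs (OrderTopology ℝ≥0)

instance : CompactIccSpace MaxAlg := inferInstanceAs (CompactIccSpace ℝ≥0)

instance : ContinuousMul MaxAlg := inferInstanceAs (ContinuousMul ℝ≥0)

instance : ContinuousAdd MaxAlg :=
  ⟨continuous_max (α := ℝ≥0)⟩

theorem add_eq_max (a b : MaxAlg) : a + b = max a b := rfl

instance : IsOrderedAddMonoid MaxAlg where
  add_le_add_left _ _ h c := max_le_max_right c h

instance : CanonicallyOrderedAdd MaxAlg where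
  exists_add_of_le {_ b} h := ⟨b, (max_eq_right h).symm⟩
  le_add_self a b := le_max_right b a
  le_self_add a b := le_max_left a b

theorem toNNReal_pow (a : MaxAlg) (k : ℕ) : toNNReal (a ^ k) = toNNReal a ^ k := by
  induction k with
  | zero => rfl
  | succ k ih => rw [pow_succ, pow_succ, toNNReal_mul, ih]

theorem exists_tendsto_of_antitone {f : ℕ → MaxAlg} (hf : Antitone f) :
    ∃ l, Filter.Tendsto f Filter.atTop (nhds l) :=
  ⟨_, tendsto_atTop_ciInf (α := ℝ≥0) (f := f) hf ⟨0, fun _ _ => bot_le⟩⟩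

theorem exists_pow_eq (a : MaxAlg) {k : ℕ} (hk : k ≠ 0) : ∃ b : MaxAlg, b ^ k = a :=
  ⟨toNNReal.symm (toNNReal a ^ ((k : ℝ)⁻¹)), toNNReal.injective <| by
    rw [toNNReal_pow, Equiv.apply_symm_apply, NNReal.rpow_inv_natCast_pow _ hk]⟩

theorem sum_le_iff {κ : Type*} {s : Finset κ} {f : κ → MaxAlg} {c : MaxAlg} :
    ∑ i ∈ s, f i ≤ c ↔ ∀ i ∈ s, f i ≤ c := by
  classical
  induction s using Finset.induction_on with
  | empty => simp
  | insert a s ha ih => rw [Finset.sum_insert ha, add_eq_max, max_le_iff, ih]; simp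

theorem le_sum {κ : Type*} {s : Finset κ} (f : κ → MaxAlg) {i : κ} (hi : i ∈ s) :
    f i ≤ ∑ j ∈ s, f j := sum_le_iff.1 le_rfl i hi

theorem exists_sum_eq {κ : Type*} {s : Finset κ} (hs : s.Nonempty) (f : κ → MaxAlg) :
    ∃ i ∈ s, ∑ j ∈ s, f j = f i := by
  obtain ⟨i, hi, h⟩ := s.exists_max_image f hs
  exact ⟨i, hi, le_antisymm (sum_le_iff.2 h) (le_sum f hi)⟩

theorem sum_pos_iff {κ : Type*} {s : Finset κ} {f : κ → MaxAlg} :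
    0 < ∑ i ∈ s, f i ↔ ∃ i ∈ s, 0 < f i := by
  simp only [← not_le, sum_le_iff, not_forall, exists_prop]

variable {ι : Type*}

section Fintype

variable [Fintype ι]

theorem mulVec_le_iff {A : Matrix ι ι MaxAlg} {v : ι → MaxAlg} {i : ι} {c : MaxAlg} :
    A.mulVec v i ≤ c ↔ ∀ j, A i j * v j ≤ c := by
  simp [Matrix.mulVec, dotProduct, sum_le_iff]

theorem mul_le_mulVec (A : Matrix ι ι MaxAlg) (v : ι → MaxAlg) (i j : ι) :
    A i j * v j ≤ A.mulVec v i := mulVec_le_iff.1 le_rfl j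

theorem exists_mulVec_eq (A : Matrix ι ι MaxAlg) (v : ι → MaxAlg) (i : ι) :
    ∃ j, A.mulVec v i = A i j * v j := by
  obtain ⟨j, -, h⟩ := exists_sum_eq ⟨i, Finset.mem_univ i⟩ (fun j => A i j * v j)
  exact ⟨j, h⟩

theorem mulVec_pos_iff {A : Matrix ι ι MaxAlg} {v : ι → MaxAlg} {i : ι} :
    0 < A.mulVec v i ↔ ∃ j, 0 < A i j ∧ 0 < v j := by
  rw [← not_le, mulVec_le_iff]
  simp [pos_iff_ne_zero, not_or]

theorem mulVec_mono (A : Matrix ι ι MaxAlg) {v w : ι → MaxAlg} (h : v ≤ w) :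
    A.mulVec v ≤ A.mulVec w := fun i =>
  mulVec_le_iff.2 fun j => (mul_le_mul_right (h j) _).trans (mul_le_mulVec A w i j)

theorem continuous_mulVec (A : Matrix ι ι MaxAlg) :
    Continuous fun v : ι → MaxAlg => A.mulVec v := by
  unfold Matrix.mulVec dotProduct
  fun_prop

theorem mulVec_congr {A : Matrix ι ι MaxAlg} {v w : ι → MaxAlg} {i : ι}
    (h : ∀ j, 0 < A i j → v j = w j) : A.mulVec v i = A.mulVec w i := by
  refine Finset.sum_congr rfl fun j _ => ?_
  rcases (zero_le (a := A i j)).eq_or_lt with h0 | h0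
  · simp [← h0]
  · rw [h j h0]

end Fintype

end

/-! ### Eigenvectors in closed invariant subsemimodules. -/

section CommonEigenvector

open Filter Topology

variable {ι : Type*} [Fintype ι]

/-- The iteration of `c⁻¹ A` decreases from a supersolution to an eigenvector. -/
theorem exists_tendsto_of_mulVec_le (A : Matrix ι ι MaxAlg) {c : MaxAlg} (hc : c ≠ 0)
    {y : ι → MaxAlg} (hy : A.mulVec y ≤ c • y) :
    ∃ x, Tendsto (fun k => (fun w => c⁻¹ • A.mulVec w)^[k] y) atTop (𝓝 x) ∧
      A.mulVec x = c • x := by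
  set T : (ι → MaxAlg) → ι → MaxAlg := fun w => c⁻¹ • A.mulVec w with hT
  have hmono : Monotone T := fun v w h i => mul_le_mul_right (mulVec_mono A h i) c⁻¹
  have hy' : T y ≤ y := fun i => by
    have h : c⁻¹ * A.mulVec y i ≤ c⁻¹ * (c * y i) := mul_le_mul_right (hy i) c⁻¹
    rwa [inv_mul_cancel_left₀ hc] at h
  have hanti : Antitone fun k => T^[k] y := hmono.antitone_iterate_of_map_le hy'
  have hcoord : ∀ i, ∃ l, Tendsto (fun k => T^[k] y i) atTop (𝓝 l) := fun i =>
    exists_tendsto_of_antitone fun _ _ h => hanti h i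
  choose x hx using hcoord
  have hlim : Tendsto (fun k => T^[k] y) atTop (𝓝 x) := tendsto_pi_nhds.2 hx
  refine ⟨x, hlim, ?_⟩
  have hcont : Continuous T := (continuous_mulVec A).const_smul c⁻¹
  have hfix : c⁻¹ • A.mulVec x = x := isFixedPt_of_tendsto_iterate hlim hcont.continuousAt
  conv_rhs => rw [← hfix]
  rw [smul_smul, mul_inv_cancel₀ hc, one_smul]

variable (A : Matrix ι ι MaxAlg) (V : Submodule MaxAlg (ι → MaxAlg))

/-- The support of a sum is the union of the supports, so an `x` in `V` of maximal support dominates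
the support of every element of `V`, in particular of `A x`. The maximum of the finitely many ratios
then serves as `c`. -/
theorem exists_mulVec_le_smul (hV : V ≠ ⊥) (hinv : ∀ v ∈ V, A.mulVec v ∈ V) :
    ∃ x ∈ V, x ≠ 0 ∧ ∃ c : MaxAlg, A.mulVec x ≤ c • x := by
  obtain ⟨S, ⟨⟨x, hx, rfl⟩, hmax⟩⟩ := Set.Finite.exists_maximal
    (s := Function.support '' (V : Set (ι → MaxAlg))) (Set.toFinite _) ⟨_, 0, V.zero_mem, rfl⟩
  have key : ∀ v ∈ V, ∀ i, x i = 0 → v i = 0 := by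
    intro v hv i hi
    have h := hmax ⟨x + v, V.add_mem hx hv, rfl⟩ (fun j hj => by
      have : 0 < x j + v j := lt_of_lt_of_le (pos_iff_ne_zero.2 hj) (le_max_left _ _)
      exact this.ne')
    by_contra h0
    have : 0 < x i + v i := lt_of_lt_of_le (pos_iff_ne_zero.2 h0) (le_max_right _ _)
    exact h (show (x + v) i ≠ 0 from this.ne') hi
  obtain ⟨v, hv, hv0⟩ := V.ne_bot_iff.1 hV
  refine ⟨x, hx, fun h => hv0 (funext fun i => key v hv i (congrFun h i)),
    ∑ i, A.mulVec x i * (x i)⁻¹, fun i => ?_⟩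
  by_cases hi : x i = 0
  · rw [key _ (hinv x hx) i hi]; exact zero_le
  · calc A.mulVec x i = A.mulVec x i * (x i)⁻¹ * x i := by rw [inv_mul_cancel_right₀ hi]
      _ ≤ _ := mul_le_mul_left (le_sum (fun i => A.mulVec x i * (x i)⁻¹) (Finset.mem_univ i)) _

/-- A smallest `c` for which `A x ≤ c x` is solvable in `V`. -/
theorem exists_minimal_mulVec_le_smul (hV : V ≠ ⊥) (hclosed : IsClosed (V : Set (ι → MaxAlg)))
    (hinv : ∀ v ∈ V, A.mulVec v ∈ V) :
    ∃ c : MaxAlg, (∃ x ∈ V, x ≠ 0 ∧ A.mulVec x ≤ c • x) ∧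
      ∀ x ∈ V, x ≠ 0 → ∀ d : MaxAlg, A.mulVec x ≤ d • x → c ≤ d := by
  obtain ⟨x₀, hx₀, hne, b, hb⟩ := exists_mulVec_le_smul A V hV hinv
  -- Normalizing the maximal entry to one and bounding the constant by a known feasible `b` makes
  -- the feasible set compact.
  let K : Set ((ι → MaxAlg) × MaxAlg) :=
    {p | p.1 ∈ V ∧ ∑ i, p.1 i = 1 ∧ p.2 ≤ b ∧ A.mulVec p.1 ≤ p.2 • p.1}
  have hmem : ∀ x ∈ V, x ≠ 0 → ∀ d : MaxAlg, d ≤ b → A.mulVec x ≤ d • x →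
      ((∑ i, x i)⁻¹ • x, d) ∈ K := by
    intro x hx hx0 d hd h
    have hs : ∑ i, x i ≠ 0 := by
      obtain ⟨i, hi⟩ := Function.ne_iff.1 hx0
      exact (sum_pos_iff.2 ⟨i, Finset.mem_univ i, pos_iff_ne_zero.2 hi⟩).ne'
    refine ⟨V.smul_mem _ hx, ?_, hd, ?_⟩
    · simp only [Pi.smul_apply, smul_eq_mul, ← Finset.mul_sum, inv_mul_cancel₀ hs]
    · simp only
      rw [Matrix.mulVec_smul, smul_comm]
      exact fun i => mul_le_mul_right (h i) _
  have hK : IsCompact K := by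
    refine isCompact_Icc.of_isClosed_subset (s := Set.Icc (0, 0) (1, b)) ?_ ?_
    · have h1 : IsClosed {p : (ι → MaxAlg) × MaxAlg | ∑ i, p.1 i = 1} :=
        isClosed_eq (by fun_prop) continuous_const
      have h2 : IsClosed {p : (ι → MaxAlg) × MaxAlg | p.2 ≤ b} :=
        isClosed_le continuous_snd continuous_const
      have h3 : IsClosed {p : (ι → MaxAlg) × MaxAlg | A.mulVec p.1 ≤ p.2 • p.1} :=
        isClosed_le ((continuous_mulVec A).comp continuous_fst)
          (continuous_snd.smul continuous_fst)
      exact (hclosed.preimage continuous_fst).inter (h1.inter (h2.inter h3))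
    · rintro ⟨x, d⟩ ⟨-, hx, hd, -⟩
      exact ⟨⟨fun _ => zero_le, zero_le⟩,
        ⟨fun i => (le_sum x (Finset.mem_univ i)).trans hx.le, hd⟩⟩
  obtain ⟨⟨x, c⟩, ⟨hxV, hx1, hcb, hxc⟩, hmin⟩ := hK.exists_isMinOn
    ⟨_, hmem x₀ hx₀ hne b le_rfl hb⟩ continuous_snd.continuousOn
  refine ⟨c, ⟨x, hxV, ?_, hxc⟩, fun y hy hy0 d hd => ?_⟩
  · rintro rfl
    simp at hx1
  · rcases le_total d b with hdb | hdb
    · exact hmin (hmem y hy hy0 d hdb hd)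
    · exact hcb.trans hdb

/-- A nonzero closed subsemimodule invariant under `A` contains an eigenvector of `A`. -/
theorem exists_eigenvector (hV : V ≠ ⊥) (hclosed : IsClosed (V : Set (ι → MaxAlg)))
    (hinv : ∀ v ∈ V, A.mulVec v ∈ V) :
    ∃ c : MaxAlg, ∃ x ∈ V, x ≠ 0 ∧ A.mulVec x = c • x := by
  obtain ⟨c, ⟨x, hx, hx0, hxc⟩, hmin⟩ := exists_minimal_mulVec_le_smul A V hV hclosed hinv
  refine ⟨c, ?_⟩
  rcases eq_or_ne c 0 with rfl | hc
  · refine ⟨x, hx, hx0, le_antisymm hxc fun i => ?_⟩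
    simp
  obtain ⟨y, hlim, hy⟩ := exists_tendsto_of_mulVec_le A hc hxc
  set T : (ι → MaxAlg) → ι → MaxAlg := fun w => c⁻¹ • A.mulVec w with hT
  have hTV : ∀ k, T^[k] x ∈ V := by
    intro k
    induction k with
    | zero => exact hx
    | succ k ih => rw [Function.iterate_succ_apply']; exact V.smul_mem _ (hinv _ ih)
  refine ⟨y, hclosed.mem_of_tendsto hlim (Eventually.of_forall hTV), ?_, hy⟩
  rintro rfl
  -- a power of `c⁻¹ A` at least halves `x`
  have hzero : ∀ k i, x i = 0 → T^[k] x i = 0 := by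
    intro k
    induction k with
    | zero => exact fun i hi => hi
    | succ k ih =>
      intro i hi
      have h1 : T^[k + 1] x i ≤ T x i := by
        have hmono : Monotone T := fun v w h i => mul_le_mul_right (mulVec_mono A h i) c⁻¹
        have hy' : T x ≤ x := fun i => by
          have h : c⁻¹ * A.mulVec x i ≤ c⁻¹ * (c * x i) := mul_le_mul_right (hxc i) c⁻¹
          rwa [inv_mul_cancel_left₀ hc] at h
        exact hmono.antitone_iterate_of_map_le hy' (Nat.le_add_left 1 k) i
      have h2 : T x i ≤ 0 := by
        have h : A.mulVec x i ≤ c * x i := hxc i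
        rw [hi, mul_zero] at h
        exact (mul_le_mul_right h c⁻¹).trans (mul_zero _).le
      exact le_antisymm (h1.trans h2) zero_le
  obtain ⟨t, ht1⟩ : ∃ t : MaxAlg, 1 < t :=
    ⟨toNNReal.symm 2, (one_lt_two : (1 : ℝ≥0) < 2)⟩
  have ht0 : t ≠ 0 := (zero_lt_one.trans ht1).ne'
  have hev : ∀ᶠ k in atTop, ∀ i, t * T^[k] x i ≤ x i := by
    rw [eventually_all]
    intro i
    rcases (zero_le (a := x i)).eq_or_lt with h | h
    · exact Eventually.of_forall fun k => by rw [hzero k i h.symm, mul_zero]; exact zero_le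
    · have := (tendsto_pi_nhds.1 hlim i).const_mul t
      rw [Pi.zero_apply, mul_zero] at this
      exact (this.eventually_lt_const h).mono fun k hk => hk.le
  obtain ⟨k, hk, hk0⟩ := (hev.and (eventually_ne_atTop 0)).exists
  obtain ⟨s, hs⟩ := exists_pow_eq t hk0
  have hs1 : 1 < s := by
    by_contra h
    exact absurd (hs ▸ pow_le_one' (not_lt.1 h) k) ht1.not_ge
  have hs0 : s ≠ 0 := (zero_lt_one.trans hs1).ne'
  -- Applying `s T` shifts the terms of `z` by one, and the overflow `s ^ k T^k x = t T^k x` is at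
  -- most `x`, the first term. So `s T z ≤ z`, that is, `A z ≤ (c / s) z` with `s > 1`, against the
  -- minimality of `c`.
  set z : ι → MaxAlg := ∑ j ∈ Finset.range k, s ^ j • T^[j] x with hz
  have hzi : ∀ i, z i = ∑ j ∈ Finset.range k, s ^ j * T^[j] x i := fun i => by
    simp [hz, Finset.sum_apply]
  have hzV : z ∈ V := V.sum_mem fun j _ => V.smul_mem _ (hTV j)
  have hxz : ∀ i, x i ≤ z i := fun i => by
    rw [hzi]
    have := le_sum (fun j => s ^ j * T^[j] x i) (Finset.mem_range.2 (Nat.pos_of_ne_zero hk0))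
    simpa using this
  have hz0 : z ≠ 0 := fun h => hx0 (funext fun i =>
    le_antisymm ((hxz i).trans_eq (congrFun h i)) zero_le)
  have hAz : A.mulVec z ≤ (c * s⁻¹) • z := by
    intro i
    have hAT : ∀ j, A.mulVec (T^[j] x) = c • T^[j + 1] x := fun j => by
      rw [Function.iterate_succ_apply', hT, smul_smul, mul_inv_cancel₀ hc, one_smul]
    have h1 : A.mulVec z i = ∑ j ∈ Finset.range k, s ^ j * (c * T^[j + 1] x i) := by
      rw [hz, Matrix.mulVec_sum, Finset.sum_apply]
      refine Finset.sum_congr rfl fun j _ => ?_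
      rw [Matrix.mulVec_smul, hAT]
      rfl
    rw [h1, sum_le_iff]
    intro j hj
    have h2 : s ^ j * (c * T^[j + 1] x i) = c * s⁻¹ * (s ^ (j + 1) * T^[j + 1] x i) := by
      rw [pow_succ]
      field_simp
    rw [h2]
    refine mul_le_mul_right ?_ _
    rcases (Nat.succ_le_of_lt (Finset.mem_range.1 hj)).eq_or_lt with h | h
    · rw [show j + 1 = k from h, hs]
      exact (hk i).trans (hxz i)
    · rw [hzi]
      exact le_sum (fun j => s ^ j * T^[j] x i) (Finset.mem_range.2 h)
  have h := hmin z hzV hz0 _ hAz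
  have h3 : c * s ≤ c * 1 := by
    have := mul_le_mul_left h s
    rw [mul_one]
    rwa [inv_mul_cancel_right₀ hs0] at this
  exact absurd (le_of_mul_le_mul_left h3 (pos_iff_ne_zero.2 hc)) hs1.not_ge

/-- The vectors `v` with `A v = c v`. -/
def eigenspace (c : MaxAlg) : Submodule MaxAlg (ι → MaxAlg) where
  carrier := {v | A.mulVec v = c • v}
  add_mem' {v w} hv hw := by
    rw [Set.mem_ofPred_eq] at *
    rw [Matrix.mulVec_add, hv, hw, smul_add]
  zero_mem' := by simp
  smul_mem' a v hv := by
    rw [Set.mem_ofPred_eq] at *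
    rw [Matrix.mulVec_smul, hv, smul_comm]

variable {A} in
theorem mem_eigenspace {c : MaxAlg} {v : ι → MaxAlg} :
    v ∈ eigenspace A c ↔ A.mulVec v = c • v := Iff.rfl

theorem isClosed_eigenspace (c : MaxAlg) : IsClosed (eigenspace A c : Set (ι → MaxAlg)) :=
  isClosed_eq (continuous_mulVec A) (continuous_const_smul c)

variable {A} in
theorem mulVec_mem_eigenspace {B : Matrix ι ι MaxAlg} (h : A * B = B * A) {c : MaxAlg}
    {v : ι → MaxAlg} (hv : v ∈ eigenspace A c) : B.mulVec v ∈ eigenspace A c := by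
  rw [mem_eigenspace] at *
  rw [Matrix.mulVec_mulVec, h, ← Matrix.mulVec_mulVec, hv, Matrix.mulVec_smul]

/-- Commuting matrices have a common eigenvector in each nonzero closed subsemimodule that is
invariant under all of them. -/
theorem exists_common_eigenvector {κ : Type*} [Finite κ] (A : κ → Matrix ι ι MaxAlg)
    (hcomm : ∀ i j, A i * A j = A j * A i) (hV : V ≠ ⊥)
    (hclosed : IsClosed (V : Set (ι → MaxAlg))) (hinv : ∀ i, ∀ v ∈ V, (A i).mulVec v ∈ V) :
    ∃ x ∈ V, x ≠ 0 ∧ ∀ i, ∃ c : MaxAlg, (A i).mulVec x = c • x := by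
  classical
  have := Fintype.ofFinite κ
  have key : ∀ s : Finset κ, ∃ W ≤ V, W ≠ ⊥ ∧ IsClosed (W : Set (ι → MaxAlg)) ∧
      (∀ i, ∀ v ∈ W, (A i).mulVec v ∈ W) ∧
      ∀ i ∈ s, ∃ c : MaxAlg, ∀ v ∈ W, (A i).mulVec v = c • v := by
    intro s
    induction s using Finset.induction_on with
    | empty => exact ⟨V, le_rfl, hV, hclosed, hinv, by simp⟩
    | insert a s _ ih =>
      obtain ⟨W, hWV, hW, hWc, hWinv, hWs⟩ := ih
      obtain ⟨c, x, hx, hx0, hxc⟩ := exists_eigenvector (A a) W hW hWc (hWinv a)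
      refine ⟨W ⊓ eigenspace (A a) c, inf_le_left.trans hWV,
        (Submodule.ne_bot_iff _).2 ⟨x, ⟨hx, hxc⟩, hx0⟩,
        hWc.inter (isClosed_eigenspace _ _),
        fun i v hv => ⟨hWinv i v hv.1, mulVec_mem_eigenspace (hcomm a i) hv.2⟩, fun i hi => ?_⟩
      rcases Finset.mem_insert.1 hi with rfl | hi
      · exact ⟨c, fun v hv => hv.2⟩
      · obtain ⟨d, hd⟩ := hWs i hi
        exact ⟨d, fun v hv => hd v hv.1⟩
  obtain ⟨W, hWV, hW, -, -, h⟩ := key Finset.univ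
  obtain ⟨x, hx, hx0⟩ := W.ne_bot_iff.1 hW
  exact ⟨x, hWV hx, hx0, fun i => (h i (Finset.mem_univ i)).imp fun c hc => hc x hx⟩

end CommonEigenvector

section

variable {ι : Type*}

/-! ### Cycle means and positive eigenvectors. -/

section CycleMean

/-- Multiply the inequalities around the cycle: the rotation only permutes the factors `z`, so they
cancel. -/
theorem prod_le_pow_of_mulVec_le {A : Matrix ι ι MaxAlg} {c : MaxAlg} {z : ι → MaxAlg}
    (hz : ∀ i, 0 < z i) (h : ∀ i j, A i j * z j ≤ c * z i) (k : ℕ) (s : Fin k → ι) :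
    ∏ j, A (s j) (s (finRotate k j)) ≤ c ^ k := by
  have h1 : ∏ j, (A (s j) (s (finRotate k j)) * z (s (finRotate k j))) ≤ ∏ j, (c * z (s j)) :=
    Finset.prod_le_prod (fun _ _ => zero_le) fun j _ => h _ _
  rw [Finset.prod_mul_distrib, Finset.prod_mul_distrib, Equiv.prod_comp (finRotate k)
    (fun j => z (s j)), Finset.prod_const, Finset.card_univ, Fintype.card_fin] at h1
  exact le_of_mul_le_mul_right h1 (Finset.prod_pos fun j _ => hz _)

variable [Fintype ι]

theorem maxCycleMean_le_iff {A : Matrix ι ι MaxAlg} {c : MaxAlg} :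
    maxCycleMean A ≤ c ↔ ∀ k, 1 ≤ k → k ≤ Fintype.card ι → ∀ s : Fin k → ι,
      ∏ j, A (s j) (s (finRotate k j)) ≤ c ^ k := by
  have hprod : ∀ (k : ℕ) (f : Fin k → MaxAlg), toNNReal (∏ j, f j) = ∏ j, toNNReal (f j) :=
    fun k f => map_prod (M := MaxAlg) (N := ℝ≥0)
      (⟨⟨toNNReal, toNNReal_one⟩, toNNReal_mul⟩ : MaxAlg →* ℝ≥0) f _
  rw [← toNNReal_le, maxCycleMean, Equiv.apply_symm_apply, Finset.sup_le_iff]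
  simp only [Finset.mem_Icc, and_imp, Finset.sup_le_iff, Finset.mem_univ, true_imp_iff]
  refine forall_congr' fun k => forall_congr' fun hk => forall_congr' fun _ =>
    forall_congr' fun s => ?_
  rw [one_div, NNReal.rpow_inv_le_iff (by exact_mod_cast hk), NNReal.rpow_natCast, ← toNNReal_le,
    toNNReal_pow, hprod]

/-- Following, from each node, an edge that attains the maximum must close a cycle; the bound on its
length is the one in `maxCycleMean`. -/
theorem exists_periodic_point {α : Type*} [Fintype α] [Nonempty α] (f : α → α) :
    ∃ p k, 1 ≤ k ∧ k ≤ Fintype.card α ∧ f^[k] p = p := by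
  obtain ⟨a⟩ := ‹Nonempty α›
  obtain ⟨m, n, hmn, h⟩ := Finite.exists_ne_map_eq_of_infinite fun n => f^[n] a
  wlog hlt : m < n generalizing m n
  · exact this n m hmn.symm h.symm (lt_of_le_of_ne (not_lt.1 hlt) hmn.symm)
  have hp : f^[n - m] (f^[m] a) = f^[m] a := by
    rw [← Function.iterate_add_apply, Nat.sub_add_cancel hlt.le]
    exact h.symm
  have hper : f^[m] a ∈ Function.periodicPts f := ⟨n - m, Nat.sub_pos_of_lt hlt, hp⟩
  exact ⟨_, Function.minimalPeriod f (f^[m] a),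
    Function.minimalPeriod_pos_of_mem_periodicPts hper, Function.minimalPeriod_le_card,
    Function.iterate_minimalPeriod⟩

/-- A positive eigenvector belongs to the maximal cycle geometric mean. -/
theorem maxCycleMean_eq [Nonempty ι] {A : Matrix ι ι MaxAlg} {c : MaxAlg} {z : ι → MaxAlg}
    (hz : ∀ i, 0 < z i) (h : A.mulVec z = c • z) : maxCycleMean A = c := by
  have hle : ∀ i j, A i j * z j ≤ c * z i := fun i j =>
    (mul_le_mulVec A z i j).trans_eq (congrFun h i)
  refine le_antisymm
    (maxCycleMean_le_iff.2 fun k _ _ s => prod_le_pow_of_mulVec_le hz hle k s) ?_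
  have hex : ∀ i, ∃ j, A i j * z j = c * z i := fun i => by
    obtain ⟨j, hj⟩ := exists_mulVec_eq A z i
    exact ⟨j, hj.symm.trans (congrFun h i)⟩
  choose f hf using hex
  obtain ⟨p, k, hk1, hk, hp⟩ := exists_periodic_point f
  obtain ⟨k, rfl⟩ : ∃ m, k = m + 1 := ⟨k - 1, by omega⟩
  let s : Fin (k + 1) → ι := fun j => f^[j] p
  have hs : ∀ j, s (finRotate (k + 1) j) = f (s j) := by
    intro j
    simp only [s, coe_finRotate]
    split_ifs with hj
    · rw [hj, Fin.val_last, ← Function.iterate_succ_apply' f, hp]; rfl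
    · rw [Function.iterate_succ_apply']
  have h1 : ∏ j, (A (s j) (s (finRotate (k + 1) j)) * z (s (finRotate (k + 1) j))) =
      ∏ j, (c * z (s j)) := Finset.prod_congr rfl fun j _ => by rw [hs, hf]
  rw [Finset.prod_mul_distrib, Finset.prod_mul_distrib, Equiv.prod_comp (finRotate (k + 1))
    (fun j => z (s j)), Finset.prod_const, Finset.card_univ, Fintype.card_fin] at h1
  have h2 := mul_right_cancel₀ (Finset.prod_pos fun j _ => hz (s j)).ne' h1
  have h3 := maxCycleMean_le_iff.1 (le_refl (maxCycleMean A)) _ hk1 hk s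
  rw [h2] at h3
  exact (pow_le_pow_iff_left₀ zero_le zero_le (Nat.succ_ne_zero k)).1 h3

end CycleMean

/-! ### Classes, access and Perron roots. -/

section Classes

variable {A : Matrix ι ι MaxAlg}

/-- The class of the node `i`. -/
def nodeClass (A : Matrix ι ι MaxAlg) (i : ι) : Set ι :=
  {j | NodeAccess A i j ∧ NodeAccess A j i}

theorem self_mem_nodeClass (i : ι) : i ∈ nodeClass A i := ⟨.refl, .refl⟩

theorem nodeClass_mem_classes (i : ι) : nodeClass A i ∈ classes A := ⟨i, rfl⟩

theorem NodeAccess.trans {i j k : ι} (h : NodeAccess A i j) (h' : NodeAccess A j k) :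
    NodeAccess A i k := Relation.ReflTransGen.trans h h'

theorem NodeAccess.of_pos {i j : ι} (h : 0 < A i j) : NodeAccess A i j :=
  Relation.ReflTransGen.single h

theorem nodeClass_eq_iff {i j : ι} :
    nodeClass A i = nodeClass A j ↔ NodeAccess A i j ∧ NodeAccess A j i := by
  constructor
  · intro h
    have : i ∈ nodeClass A j := h ▸ self_mem_nodeClass i
    exact ⟨this.2, this.1⟩
  · rintro ⟨h1, h2⟩
    ext k
    exact ⟨fun hk => ⟨h2.trans hk.1, hk.2.trans h1⟩, fun hk => ⟨h1.trans hk.1, hk.2.trans h2⟩⟩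

theorem nodeClass_eq_of_mem {i j : ι} (h : j ∈ nodeClass A i) : nodeClass A j = nodeClass A i :=
  nodeClass_eq_iff.2 ⟨h.2, h.1⟩

theorem access_nodeClass_iff {i j : ι} :
    Access A (nodeClass A i) (nodeClass A j) ↔ NodeAccess A i j := by
  constructor
  · rintro ⟨-, -, h⟩
    have key : ∀ ν, Relation.ReflTransGen (ReducedAdj A) (nodeClass A i) ν →
        ∀ k ∈ ν, NodeAccess A i k := by
      intro ν hν
      induction hν with
      | refl => exact fun k hk => hk.1
      | tail _ hadj ih =>
        obtain ⟨-, ⟨m, rfl⟩, p, hp, q, hq, hpq⟩ := hadj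
        exact fun k hk => (ih p hp).trans ((NodeAccess.of_pos hpq).trans (hq.2.trans hk.1))
    exact key _ h j (self_mem_nodeClass j)
  · intro h
    refine ⟨nodeClass_mem_classes i, nodeClass_mem_classes j, ?_⟩
    induction h with
    | refl => exact .refl
    | @tail b c _ hbc ih =>
      exact ih.tail ⟨nodeClass_mem_classes b, nodeClass_mem_classes c, b, self_mem_nodeClass b,
        c, self_mem_nodeClass c, hbc⟩

theorem access_iff {μ ν : Set ι} :
    Access A μ ν ↔ ∃ i j, μ = nodeClass A i ∧ ν = nodeClass A j ∧ NodeAccess A i j := by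
  constructor
  · intro h
    obtain ⟨i, rfl⟩ := h.1
    obtain ⟨j, rfl⟩ := h.2.1
    exact ⟨i, j, rfl, rfl, access_nodeClass_iff.1 h⟩
  · rintro ⟨i, j, rfl, rfl, h⟩
    exact access_nodeClass_iff.2 h

theorem isInitial_nodeClass_iff {j : ι} :
    IsInitial A (nodeClass A j) ↔ ∀ i, NodeAccess A i j → NodeAccess A j i := by
  constructor
  · exact fun h i hi => (nodeClass_eq_iff.1 (h.2 _ (access_nodeClass_iff.2 hi))).2
  · refine fun h => ⟨nodeClass_mem_classes j, fun μ hμ => ?_⟩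
    obtain ⟨i, rfl⟩ := hμ.1
    have := access_nodeClass_iff.1 hμ
    exact nodeClass_eq_iff.2 ⟨this, h i this⟩

/-- A subeigenvector and a supereigenvector, both positive on a nonempty finite set, compare. -/
theorem le_of_sub_of_super {T : Finset ι} (hT : T.Nonempty) {u v : ι → MaxAlg} {b c : MaxAlg}
    (hu : ∀ i ∈ T, 0 < u i) (hv : ∀ i ∈ T, 0 < v i)
    (hsub : ∀ i ∈ T, ∃ l ∈ T, b * u i ≤ A i l * u l)
    (hsup : ∀ i ∈ T, ∀ l ∈ T, A i l * v l ≤ c * v i) : b ≤ c := by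
  -- At a node maximizing `u / v`, the two inequalities along the edge given by `hsub` can be
  -- chained.
  obtain ⟨i, hi, hmax⟩ := T.exists_max_image (fun i => u i * (v i)⁻¹) hT
  obtain ⟨l, hl, h⟩ := hsub i hi
  have h1 : u l * v i ≤ u i * v l := by
    have := mul_le_mul_left (hmax l hl) (v l * v i)
    calc u l * v i = u l * (v l)⁻¹ * (v l * v i) := by
          rw [mul_assoc, inv_mul_cancel_left₀ (hv l hl).ne']
      _ ≤ _ := this
      _ = u i * v l := by
          rw [mul_comm (v l), mul_assoc, inv_mul_cancel_left₀ (hv i hi).ne']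
  have h2 : b * (u i * v l) ≤ c * (u i * v l) :=
    calc b * (u i * v l) = b * u i * v l := by ring
      _ ≤ A i l * u l * v l := mul_le_mul_left h _
      _ = A i l * v l * u l := by ring
      _ ≤ c * v i * u l := mul_le_mul_left (hsup i hi l hl) _
      _ = c * (u l * v i) := by ring
      _ ≤ c * (u i * v l) := mul_le_mul_right h1 _
  exact le_of_mul_le_mul_right h2 (mul_pos (hu i hi) (hv l hl))

variable [Fintype ι]

theorem isSpectral_nodeClass_iff {j : ι} :
    IsSpectral A (nodeClass A j) ↔ (∀ i, NodeAccess A i j → NodeAccess A j i) ∨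
      0 < perronRoot A (nodeClass A j) ∧
        ∀ i, NodeAccess A i j → perronRoot A (nodeClass A i) ≤ perronRoot A (nodeClass A j) := by
  rw [IsSpectral, isInitial_nodeClass_iff, and_iff_right (nodeClass_mem_classes j)]
  refine or_congr_right (and_congr_right fun _ => ⟨fun h i hi => h _ (access_nodeClass_iff.2 hi),
    fun h μ hμ => ?_⟩)
  obtain ⟨i, rfl⟩ := hμ.1
  exact h i (access_nodeClass_iff.1 hμ)

/-- A vector supported on a class and satisfying the eigenvector equation there is positive on the
class and belongs to its Perron root. -/
theorem pos_and_perronRoot_eq {p : ι} {z : ι → MaxAlg} {c : MaxAlg}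
    (hsupp : ∀ i, 0 < z i → i ∈ nodeClass A p) (hne : z ≠ 0)
    (hz : ∀ i ∈ nodeClass A p, A.mulVec z i = c * z i) :
    (∀ i ∈ nodeClass A p, 0 < z i) ∧ perronRoot A (nodeClass A p) = c := by
  classical
  obtain ⟨l, hl⟩ := Function.ne_iff.1 hne
  have hl : 0 < z l := pos_iff_ne_zero.2 hl
  have hlp := hsupp l hl
  have hpos : ∀ i ∈ nodeClass A p, 0 < z i := by
    intro i hi
    have hil : NodeAccess A i l := hi.2.trans hlp.1
    rcases eq_or_ne c 0 with rfl | hc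
    · rcases Relation.ReflTransGen.cases_tail hil with rfl | ⟨m, him, hml⟩
      · exact hl
      · have hm : m ∈ nodeClass A p :=
          ⟨hi.1.trans him, (NodeAccess.of_pos hml).trans hlp.2⟩
        have h := hz m hm
        rw [zero_mul] at h
        exact absurd h (mulVec_pos_iff.2 ⟨l, hml, hl⟩).ne'
    · clear hlp
      have : NodeAccess A p i := hi.1
      clear hi
      induction hil using Relation.ReflTransGen.head_induction_on with
      | refl => exact hl
      | @head a b hab hbl ih =>
        have hb : 0 < z b := ih (this.trans (.of_pos hab))
        have ha : a ∈ nodeClass A p := ⟨this, (NodeAccess.of_pos hab).trans (hsupp b hb).2⟩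
        have h : 0 < A.mulVec z a := mulVec_pos_iff.2 ⟨b, hab, hb⟩
        rw [hz a ha] at h
        exact pos_iff_ne_zero.2 fun h0 => by simp [h0] at h
  refine ⟨hpos, ?_⟩
  have : Nonempty (nodeClass A p) := ⟨⟨p, self_mem_nodeClass p⟩⟩
  refine maxCycleMean_eq (z := fun i : nodeClass A p => z i) (fun i => hpos i i.2) ?_
  ext i
  rw [Pi.smul_apply, smul_eq_mul, ← hz i i.2]
  refine le_antisymm (mulVec_le_iff.2 fun j => mul_le_mulVec A z i j) (mulVec_le_iff.2 fun j => ?_)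
  rcases (zero_le (a := z j)).eq_or_lt with h | h
  · rw [← h, mul_zero]; exact zero_le
  · exact mul_le_mulVec (A.submatrix (fun i : nodeClass A p => (i : ι)) fun i => (i : ι))
      (fun i : nodeClass A p => z i) i ⟨j, hsupp j h⟩

end Classes

end

section

variable {ι : Type*}

/-! ### Diagonal blocks and their common eigenvectors. -/

section ClassVector

/-- The vectors supported in `S`. -/
def supported (S : Set ι) : Submodule MaxAlg (ι → MaxAlg) where
  carrier := {v | ∀ i, i ∉ S → v i = 0}
  add_mem' {v w} hv hw i hi := by rw [Pi.add_apply, hv i hi, hw i hi, add_zero]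
  zero_mem' _ _ := rfl
  smul_mem' a v hv i hi := by rw [Pi.smul_apply, hv i hi, smul_zero]

theorem mem_supported {S : Set ι} {v : ι → MaxAlg} :
    v ∈ supported S ↔ ∀ i, i ∉ S → v i = 0 := Iff.rfl

theorem mem_of_mem_supported {S : Set ι} {v : ι → MaxAlg} (hv : v ∈ supported S) {i : ι}
    (hi : 0 < v i) : i ∈ S := by
  by_contra h
  exact hi.ne' (hv i h)

theorem isClosed_supported (S : Set ι) : IsClosed (supported S : Set (ι → MaxAlg)) := by
  have : (supported S : Set (ι → MaxAlg)) = ⋂ i, ⋂ _ : i ∉ S, {v | v i = 0} := by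
    ext v
    simp [mem_supported]
  rw [this]
  exact isClosed_iInter fun i => isClosed_iInter fun _ =>
    isClosed_eq (continuous_apply i) continuous_const

open Classical in
/-- The matrix `A` with all entries outside `S × S` replaced by zero. -/
def restrict (A : Matrix ι ι MaxAlg) (S : Set ι) : Matrix ι ι MaxAlg :=
  fun i j => if i ∈ S ∧ j ∈ S then A i j else 0

theorem nodeClass_congr {A B : Matrix ι ι MaxAlg} (h : NodeAccess A = NodeAccess B) (i : ι) :
    nodeClass A i = nodeClass B i := by rw [nodeClass, h]; rfl

variable [Fintype ι]

theorem restrict_mulVec_of_mem {A : Matrix ι ι MaxAlg} {S : Set ι} {v : ι → MaxAlg}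
    (hv : v ∈ supported S) {i : ι} (hi : i ∈ S) :
    (restrict A S).mulVec v i = A.mulVec v i := by
  refine Finset.sum_congr rfl fun j _ => ?_
  by_cases hj : j ∈ S
  · simp [restrict, hi, hj]
  · simp [hv j hj]

theorem restrict_mulVec_of_notMem (A : Matrix ι ι MaxAlg) {S : Set ι} (v : ι → MaxAlg) {i : ι}
    (hi : i ∉ S) : (restrict A S).mulVec v i = 0 :=
  Finset.sum_eq_zero fun j _ => by simp [restrict, hi]

/-- Two-step paths from `S` to `S` do not leave `S`, so no term of the product is lost. Classes have
this convexity, hence diagonal blocks of commuting matrices commute. -/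
theorem restrict_mul_restrict {A B : Matrix ι ι MaxAlg} {S : Set ι}
    (h : ∀ i ∈ S, ∀ j ∈ S, ∀ m, 0 < A i m → 0 < B m j → m ∈ S) :
    restrict A S * restrict B S = restrict (A * B) S := by
  ext i j
  rw [Matrix.mul_apply]
  by_cases hij : i ∈ S ∧ j ∈ S
  · rw [restrict, if_pos hij, Matrix.mul_apply]
    refine Finset.sum_congr rfl fun m _ => ?_
    by_cases hm : m ∈ S
    · simp [restrict, hij, hm]
    · have : ¬ (0 < A i m ∧ 0 < B m j) := fun h' => hm (h i hij.1 j hij.2 m h'.1 h'.2)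
      rw [not_and_or, pos_iff_ne_zero, pos_iff_ne_zero, not_not, not_not] at this
      rcases this with h0 | h0 <;> simp [restrict, hm, h0]
  · rw [restrict, if_neg hij]
    refine Finset.sum_eq_zero fun m _ => ?_
    rcases not_and_or.1 hij with h0 | h0 <;> simp [restrict, h0]

/-- Commuting matrices with the same access relation have, for each class, a common eigenvector
of their diagonal blocks, which is positive on the class. -/
theorem exists_common_class_vector {κ : Type*} [Finite κ] [Nonempty κ]
    (A : κ → Matrix ι ι MaxAlg) (hcomm : ∀ i j, A i * A j = A j * A i) (C : Matrix ι ι MaxAlg)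
    (hC : ∀ k, NodeAccess (A k) = NodeAccess C) (p : ι) :
    ∃ u : ι → MaxAlg, (∀ i, 0 < u i ↔ i ∈ nodeClass C p) ∧
      ∀ k, ∀ i ∈ nodeClass C p, (A k).mulVec u i = perronRoot (A k) (nodeClass C p) * u i := by
  classical
  set S := nodeClass C p with hS
  have hconv : ∀ k l, ∀ i ∈ S, ∀ j ∈ S, ∀ m, 0 < A k i m → 0 < A l m j → m ∈ S := by
    intro k l i hi j hj m h1 h2
    have h1' : NodeAccess C i m := hC k ▸ NodeAccess.of_pos h1
    have h2' : NodeAccess C m j := hC l ▸ NodeAccess.of_pos h2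
    exact ⟨hi.1.trans h1', h2'.trans hj.2⟩
  obtain ⟨u, hu, hu0, h⟩ := exists_common_eigenvector (supported S) (fun k => restrict (A k) S)
    (fun k l => by
      rw [restrict_mul_restrict (hconv k l), restrict_mul_restrict (hconv l k), hcomm])
    ((Submodule.ne_bot_iff _).2 ⟨Pi.single p 1, fun i hi => by
      rw [Pi.single_eq_of_ne]
      rintro rfl
      exact hi (self_mem_nodeClass _), fun h0 => by simpa using congrFun h0 p⟩)
    (isClosed_supported S) (fun k v _ i hi => restrict_mulVec_of_notMem _ _ hi)
  have key : ∀ k, (∀ i ∈ S, 0 < u i) ∧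
      ∀ i ∈ S, (A k).mulVec u i = perronRoot (A k) S * u i := by
    intro k
    obtain ⟨c, hc⟩ := h k
    have hcl : nodeClass (A k) p = S := nodeClass_congr (hC k) p
    have hc' : ∀ i ∈ S, (A k).mulVec u i = c * u i := fun i hi => by
      rw [← restrict_mulVec_of_mem hu hi, hc]; rfl
    have := pos_and_perronRoot_eq (A := A k) (p := p) (z := u) (c := c)
      (fun i hi => hcl ▸ mem_of_mem_supported hu hi) hu0 (fun i hi => hc' i (hcl ▸ hi))
    rw [hcl] at this
    rw [this.2]
    exact ⟨this.1, hc'⟩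
  obtain ⟨k₀⟩ := ‹Nonempty κ›
  exact ⟨u, fun i => ⟨mem_of_mem_supported hu, (key k₀).1 i⟩, fun k => (key k).2⟩

theorem exists_class_vector (A : Matrix ι ι MaxAlg) (p : ι) :
    ∃ u : ι → MaxAlg, (∀ i, 0 < u i ↔ i ∈ nodeClass A p) ∧
      ∀ i ∈ nodeClass A p, A.mulVec u i = perronRoot A (nodeClass A p) * u i := by
  obtain ⟨u, hu, h⟩ := exists_common_class_vector (fun _ : Unit => A) (fun _ _ => rfl) A
    (fun _ => rfl) p
  exact ⟨u, hu, h ()⟩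

end ClassVector

/-! ### Ranking nodes by reachability. -/

section Height

variable [Fintype ι] {A : Matrix ι ι MaxAlg}

/-- The number of nodes to which `i` has access. -/
def height (A : Matrix ι ι MaxAlg) (i : ι) : ℕ := {l | NodeAccess A i l}.ncard

/-- The number of nodes with access to `i`. -/
def coheight (A : Matrix ι ι MaxAlg) (i : ι) : ℕ := {l | NodeAccess A l i}.ncard

theorem height_le {i j : ι} (h : NodeAccess A i j) : height A j ≤ height A i :=
  Set.ncard_le_ncard (fun _ hl => h.trans hl) (Set.toFinite _)

theorem coheight_le {i j : ι} (h : NodeAccess A i j) : coheight A i ≤ coheight A j :=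
  Set.ncard_le_ncard (fun _ hl => NodeAccess.trans hl h) (Set.toFinite _)

/-- Height drops strictly on leaving a class: equal counts of nested sets of successors force the
sets to agree, and `i` is its own successor. -/
theorem nodeAccess_of_height_le {i j : ι} (h : NodeAccess A i j)
    (hle : height A i ≤ height A j) : NodeAccess A j i := by
  have : {l | NodeAccess A j l} = {l | NodeAccess A i l} :=
    Set.eq_of_subset_of_ncard_le (fun _ hl => h.trans hl) hle (Set.toFinite _)
  exact (Set.ext_iff.1 this i).2 .refl

theorem nodeAccess_of_coheight_le {i j : ι} (h : NodeAccess A i j)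
    (hle : coheight A j ≤ coheight A i) : NodeAccess A j i := by
  have : {l | NodeAccess A l i} = {l | NodeAccess A l j} :=
    Set.eq_of_subset_of_ncard_le (fun _ hl => NodeAccess.trans hl h) hle (Set.toFinite _)
  exact (Set.ext_iff.1 this j).2 .refl

end Height

/-- If the classes of `A` have distinct Perron roots, then the edges of a matrix commuting with `A`
respect the access relation of `A`. -/
theorem nodeAccess_of_commute [Fintype ι] {A B : Matrix ι ι MaxAlg}
    (hdist : Set.InjOn (perronRoot A) (classes A)) (hcomm : A * B = B * A) {i j : ι}
    (hij : 0 < B i j) : NodeAccess A i j := by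
  classical
  by_contra hbad
  -- Among the bad edges of `B`, start as low and end as high in the access order of `A` as
  -- possible.
  obtain ⟨⟨p, q⟩, ⟨hpq, hnot⟩, hmin⟩ := Set.exists_min_image
    {e : ι × ι | 0 < B e.1 e.2 ∧ ¬ NodeAccess A e.1 e.2}
    (fun e => height A e.1 + coheight A e.2) (Set.toFinite _) ⟨(i, j), hij, hbad⟩
  simp only at hpq hnot
  -- Such an edge from `l` to `m` is bad too, so minimality keeps `l` from lying strictly below the
  -- class of `p`.
  have hrow : ∀ k ∈ nodeClass A p, ∀ m ∈ nodeClass A q, ∀ l, NodeAccess A k l → 0 < B l m →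
      l ∈ nodeClass A p := by
    intro k hk m hm l hkl hlm
    have h1 : ¬ NodeAccess A l m := fun h => hnot (hk.1.trans (hkl.trans (h.trans hm.2)))
    have h2 := hmin (l, m) ⟨hlm, h1⟩
    have h3 := coheight_le hm.2
    simp only at h2
    exact ⟨hk.1.trans hkl, nodeAccess_of_height_le (hk.1.trans hkl) (by omega)⟩
  have hcol : ∀ k ∈ nodeClass A p, ∀ m ∈ nodeClass A q, ∀ l, NodeAccess A l m → 0 < B k l →
      l ∈ nodeClass A q := by
    intro k hk m hm l hlm hkl
    have h1 : ¬ NodeAccess A k l := fun h => hnot (hk.1.trans (h.trans (hlm.trans hm.2)))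
    have h2 := hmin (k, l) ⟨hkl, h1⟩
    have h3 := height_le hk.1
    simp only at h2
    exact ⟨nodeAccess_of_coheight_le (hlm.trans hm.2) (by omega), hlm.trans hm.2⟩
  obtain ⟨u, hu, hAu⟩ := exists_class_vector A q
  -- By `hrow` and `hcol` only the diagonal blocks of `A` contribute to `A B u = B A u` on the class
  -- of `p`, so `z` is an eigenvector of that block with the root of the class of `q`.
  let z : ι → MaxAlg := fun k => if k ∈ nodeClass A p then B.mulVec u k else 0
  have hzp : 0 < z p := by
    simp only [z, if_pos (self_mem_nodeClass p)]
    exact mulVec_pos_iff.2 ⟨q, hpq, (hu q).2 (self_mem_nodeClass q)⟩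
  have hz : ∀ k ∈ nodeClass A p,
      A.mulVec z k = perronRoot A (nodeClass A q) * z k := by
    intro k hk
    have h1 : A.mulVec z k = A.mulVec (B.mulVec u) k := mulVec_congr fun l hkl => by
      simp only [z]
      split_ifs with hl
      · rfl
      · by_contra h0
        obtain ⟨m, hlm, hm⟩ := mulVec_pos_iff.1 (pos_iff_ne_zero.2 (Ne.symm h0))
        exact hl (hrow k hk m ((hu m).1 hm) l (.of_pos hkl) hlm)
    have h2 : B.mulVec (A.mulVec u) k = B.mulVec (perronRoot A (nodeClass A q) • u) k :=
      mulVec_congr fun l hkl => by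
        by_cases hl : l ∈ nodeClass A q
        · exact hAu l hl
        · have hul : u l = 0 := by
            by_contra h0
            exact hl ((hu l).1 (pos_iff_ne_zero.2 h0))
          rw [Pi.smul_apply, hul, smul_zero]
          by_contra h0
          obtain ⟨m, hlm, hm⟩ := mulVec_pos_iff.1 (pos_iff_ne_zero.2 h0)
          exact hl (hcol k hk m ((hu m).1 hm) l (.of_pos hlm) hkl)
    rw [h1, Matrix.mulVec_mulVec, hcomm, ← Matrix.mulVec_mulVec, h2, Matrix.mulVec_smul,
      Pi.smul_apply, smul_eq_mul]
    simp only [z, if_pos hk]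
  have hroot := (pos_and_perronRoot_eq (A := A) (p := p) (z := z)
    (fun k hk => by
      by_contra h0
      simp only [z, if_neg h0] at hk
      exact hk.ne rfl) (fun h0 => hzp.ne' (congrFun h0 p)) hz).2
  exact hnot (nodeClass_eq_iff.1
    (hdist (nodeClass_mem_classes p) (nodeClass_mem_classes q) hroot)).1

end

/-! ### Eigenvectors and spectral classes. -/

section Spectral

open Filter Topology

variable {ι : Type*} [Fintype ι] {A : Matrix ι ι MaxAlg}

theorem pos_of_nodeAccess {v : ι → MaxAlg} {c : MaxAlg} (hv : A.mulVec v = c • v)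
    {i j : ι} (hij : NodeAccess A i j) (hj : 0 < v j) : 0 < v i := by
  induction hij using Relation.ReflTransGen.head_induction_on with
  | refl => exact hj
  | @head a b hab _ ih =>
    have h : 0 < A.mulVec v a := mulVec_pos_iff.2 ⟨b, hab, ih⟩
    rw [hv] at h
    exact pos_iff_ne_zero.2 fun h0 => by simp [h0] at h

theorem exists_le_of_class_vector {u : ι → MaxAlg} {p : ι} {c : MaxAlg}
    (hu : ∀ i, 0 < u i ↔ i ∈ nodeClass A p) (h : ∀ i ∈ nodeClass A p, A.mulVec u i = c * u i)
    {k : ι} (hk : k ∈ nodeClass A p) : ∃ l ∈ nodeClass A p, c * u k ≤ A k l * u l := by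
  rcases eq_or_ne c 0 with rfl | hc
  · exact ⟨k, hk, by rw [zero_mul]; exact zero_le⟩
  · obtain ⟨l, hl⟩ := exists_mulVec_eq A u k
    rw [h k hk] at hl
    refine ⟨l, (hu l).1 (pos_iff_ne_zero.2 fun h0 => ?_), hl.le⟩
    rw [h0, mul_zero] at hl
    exact (mul_ne_zero hc ((hu k).2 hk).ne') hl

/-- The support is closed under predecessors, so it contains the whole class, where `v` is a
supereigenvector to compare with the class vector. -/
theorem perronRoot_le_of_eigenvector {v : ι → MaxAlg} {c : MaxAlg}
    (hv : A.mulVec v = c • v) {i : ι} (hi : 0 < v i) : perronRoot A (nodeClass A i) ≤ c := by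
  classical
  obtain ⟨u, hu, h⟩ := exists_class_vector A i
  refine le_of_sub_of_super (A := A) (T := Finset.univ.filter (· ∈ nodeClass A i)) (u := u)
    (v := v) ⟨i, by simpa using self_mem_nodeClass i⟩ ?_ ?_ ?_ ?_
  · exact fun k hk => (hu k).2 (Finset.mem_filter.1 hk).2
  · exact fun k hk => pos_of_nodeAccess hv (Finset.mem_filter.1 hk).2.2 hi
  · intro k hk
    obtain ⟨l, hl, hle⟩ := exists_le_of_class_vector hu h (Finset.mem_filter.1 hk).2
    exact ⟨l, Finset.mem_filter.2 ⟨Finset.mem_univ l, hl⟩, hle⟩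
  · exact fun k _ l _ => (mul_le_mulVec A v k l).trans_eq (congrFun hv k)

/-- An eigenvector whose support is cofinal in the predecessors of a class belongs to the Perron
root of that class, and the class is spectral. -/
theorem isSpectral_of_eigenvector {v : ι → MaxAlg} {c : MaxAlg} (hv : A.mulVec v = c • v) {q : ι}
    (hq : ∃ i ∈ nodeClass A q, 0 < v i) (hsupp : ∀ i, 0 < v i → NodeAccess A i q) :
    perronRoot A (nodeClass A q) = c ∧ IsSpectral A (nodeClass A q) := by
  classical
  -- Truncation to the class changes nothing there: a support node reached from the class has access
  -- back to `q`.
  let z : ι → MaxAlg := fun k => if k ∈ nodeClass A q then v k else 0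
  have hz : ∀ k ∈ nodeClass A q, A.mulVec z k = c * z k := by
    intro k hk
    have h1 : A.mulVec z k = A.mulVec v k := mulVec_congr fun l hkl => by
      simp only [z]
      split_ifs with hl
      · rfl
      · by_contra h0
        exact hl ⟨hk.1.trans (.of_pos hkl), hsupp l (pos_iff_ne_zero.2 (Ne.symm h0))⟩
    rw [h1, hv]
    simp only [z, if_pos hk]
    rfl
  obtain ⟨i₀, hi₀, hpos₀⟩ := hq
  obtain ⟨hpos, hroot⟩ := pos_and_perronRoot_eq (A := A) (p := q) (z := z)
    (fun k hk => by
      by_contra h0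
      simp only [z, if_neg h0] at hk
      exact hk.ne rfl)
    (fun h0 => by
      have := congrFun h0 i₀
      simp only [z, if_pos hi₀] at this
      exact hpos₀.ne' this) hz
  have hvq : 0 < v q := by
    have := hpos q (self_mem_nodeClass q)
    simpa only [z, if_pos (self_mem_nodeClass q)] using this
  refine ⟨hroot, isSpectral_nodeClass_iff.2 ?_⟩
  rw [hroot]
  -- If `A v = 0`, then no edge enters `q`, so the class is initial.
  rcases eq_or_ne c 0 with rfl | hc
  · refine Or.inl fun i hi => ?_
    rcases Relation.ReflTransGen.cases_tail hi with rfl | ⟨m, -, hm⟩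
    · exact .refl
    · have h : 0 < A.mulVec v m := mulVec_pos_iff.2 ⟨q, hm, hvq⟩
      rw [hv, zero_smul] at h
      exact absurd rfl h.ne
  · exact Or.inr ⟨pos_iff_ne_zero.2 hc, fun i hi =>
      perronRoot_le_of_eigenvector hv (pos_of_nodeAccess hv hi hvq)⟩

/-- From `j`, descend to a lowest class meeting the support. For `c ≠ 0` the entries attaining the
maxima in `A v` stay in that class, so `v` is a subeigenvector there and its root is at least `c`.
For `c = 0` no edge enters `j`, and the class of `j` itself has root zero. -/
theorem exists_nodeAccess_perronRoot_eq {v : ι → MaxAlg} {c : MaxAlg} (hv : A.mulVec v = c • v)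
    {j : ι} (hj : 0 < v j) :
    ∃ i, NodeAccess A j i ∧ 0 < v i ∧ perronRoot A (nodeClass A i) = c := by
  classical
  rcases eq_or_ne c 0 with rfl | hc
  · refine ⟨j, .refl, hj, (pos_and_perronRoot_eq (A := A) (p := j) (z := Pi.single j 1)
      (fun i hi => ?_) (fun h0 => by simpa using congrFun h0 j) fun i _ => ?_).2⟩
    · rcases eq_or_ne i j with rfl | hne
      · exact self_mem_nodeClass i
      · rw [Pi.single_eq_of_ne hne] at hi
        exact absurd rfl hi.ne
    · rw [zero_mul]
      by_contra h0
      obtain ⟨l, hl, hl'⟩ := mulVec_pos_iff.1 (pos_iff_ne_zero.2 h0)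
      rcases eq_or_ne l j with rfl | hne
      · have h : 0 < A.mulVec v i := mulVec_pos_iff.2 ⟨l, hl, hj⟩
        rw [hv, zero_smul] at h
        exact absurd rfl h.ne
      · rw [Pi.single_eq_of_ne hne] at hl'
        exact absurd rfl hl'.ne
  · obtain ⟨i, ⟨hji, hi⟩, hmin⟩ := Set.exists_min_image {l | NodeAccess A j l ∧ 0 < v l}
      (height A) (Set.toFinite _) ⟨j, .refl, hj⟩
    refine ⟨i, hji, hi, le_antisymm (perronRoot_le_of_eigenvector hv hi) ?_⟩
    obtain ⟨u, hu, h⟩ := exists_class_vector A i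
    refine le_of_sub_of_super (A := A)
      (T := Finset.univ.filter fun l => l ∈ nodeClass A i ∧ 0 < v l) (u := v) (v := u)
      ⟨i, by simpa using ⟨self_mem_nodeClass i, hi⟩⟩ ?_ ?_ ?_ ?_
    · exact fun k hk => (Finset.mem_filter.1 hk).2.2
    · exact fun k hk => (hu k).2 (Finset.mem_filter.1 hk).2.1
    · intro k hk
      obtain ⟨hki, hk⟩ := (Finset.mem_filter.1 hk).2
      obtain ⟨l, hl⟩ := exists_mulVec_eq A v k
      rw [hv, Pi.smul_apply, smul_eq_mul] at hl
      have hpos : 0 < A k l * v l := hl ▸ mul_pos (pos_iff_ne_zero.2 hc) hk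
      have hkl : 0 < A k l := pos_iff_ne_zero.2 fun h0 => by simp [h0] at hpos
      have hvl : 0 < v l := pos_iff_ne_zero.2 fun h0 => by simp [h0] at hpos
      have hil : NodeAccess A i l := hki.1.trans (.of_pos hkl)
      exact ⟨l, Finset.mem_filter.2 ⟨Finset.mem_univ l,
        ⟨hil, nodeAccess_of_height_le hil (hmin l ⟨hji.trans hil, hvl⟩)⟩, hvl⟩, hl.le⟩
    · intro k hk l _
      exact (mul_le_mulVec A u k l).trans_eq (h k (Finset.mem_filter.1 hk).2.1)

/-- If the classes of `A` have distinct Perron roots, then the support of an eigenvector has a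
single final class. -/
theorem exists_final_node (hdist : Set.InjOn (perronRoot A) (classes A)) {v : ι → MaxAlg}
    (hv0 : v ≠ 0) {c : MaxAlg} (hv : A.mulVec v = c • v) :
    ∃ q, 0 < v q ∧ ∀ i, 0 < v i → NodeAccess A i q := by
  obtain ⟨j, hj⟩ := Function.ne_iff.1 hv0
  obtain ⟨q, -, hq, hqc⟩ := exists_nodeAccess_perronRoot_eq hv (pos_iff_ne_zero.2 hj)
  refine ⟨q, hq, fun i hi => ?_⟩
  obtain ⟨m, him, -, hmc⟩ := exists_nodeAccess_perronRoot_eq hv hi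
  exact him.trans (nodeClass_eq_iff.1 (hdist (nodeClass_mem_classes m)
    (nodeClass_mem_classes q) (hmc.trans hqc.symm))).1

/-- If all classes with access to the node `q` have Perron root at most `c`, then `A y ≤ c y` is
solvable on the predecessors of `q`. -/
theorem exists_supersolution {q : ι} {c : MaxAlg} (hc : 0 < c)
    (hle : ∀ i, NodeAccess A i q → perronRoot A (nodeClass A i) ≤ c) :
    ∃ y : ι → MaxAlg, (∀ i, 0 < y i ↔ NodeAccess A i q) ∧ A.mulVec y ≤ c • y ∧
      ∃ u : ι → MaxAlg, (∀ i, 0 < u i ↔ i ∈ nodeClass A q) ∧ u ≤ y ∧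
        ∀ i ∈ nodeClass A q, A.mulVec u i = perronRoot A (nodeClass A q) * u i := by
  classical
  have hU : ∀ S : classes A, ∃ u : ι → MaxAlg, (∀ i, 0 < u i ↔ i ∈ (S : Set ι)) ∧
      ∀ i ∈ (S : Set ι), A.mulVec u i = perronRoot A S * u i := by
    rintro ⟨_, p, rfl⟩
    exact exists_class_vector A p
  choose U hUpos hU using hU
  let w : ι → MaxAlg := fun i => U ⟨nodeClass A i, nodeClass_mem_classes i⟩ i
  have hw : ∀ i, 0 < w i := fun i => (hUpos _ i).2 (self_mem_nodeClass i)
  have hwU : ∀ i l, l ∈ nodeClass A i → w l = U ⟨nodeClass A i, nodeClass_mem_classes i⟩ l := by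
    intro i l hl
    have : (⟨nodeClass A l, nodeClass_mem_classes l⟩ : classes A) =
      ⟨nodeClass A i, nodeClass_mem_classes i⟩ := Subtype.ext (nodeClass_eq_of_mem hl)
    simp only [w, this]
  -- The sums are maxima: `K` is at least one and bounds the excess of every entry.
  let K : MaxAlg := 1 + ∑ i, ∑ l, A i l * w l * (c * w i)⁻¹
  have hK1 : 1 ≤ K := le_max_left _ _
  have hK : ∀ i l, A i l * w l ≤ K * (c * w i) := by
    intro i l
    have h1 : A i l * w l * (c * w i)⁻¹ ≤ K :=
      ((le_sum (fun l => A i l * w l * (c * w i)⁻¹) (Finset.mem_univ l)).trans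
        (le_sum (fun i => ∑ l, A i l * w l * (c * w i)⁻¹) (Finset.mem_univ i))).trans
        (le_max_right _ _)
    have h2 := mul_le_mul_left h1 (c * w i)
    rwa [inv_mul_cancel_right₀ (mul_pos hc (hw i)).ne'] at h2
  -- Within a class the root is at most `c`, so no correction is needed; an edge leaving a class
  -- lowers the height and gains the factor `K` that absorbs the excess.
  let y : ι → MaxAlg := fun i => if NodeAccess A i q then K ^ height A i * w i else 0
  have hKpos : ∀ k : ℕ, 0 < K ^ k := fun k => pow_pos (zero_lt_one.trans_le hK1) k
  refine ⟨y, fun i => ?_, fun i => mulVec_le_iff.2 fun l => ?_,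
    K ^ height A q • U ⟨nodeClass A q, nodeClass_mem_classes q⟩, fun i => ?_, fun i => ?_,
    fun i hi => ?_⟩
  · simp only [y]
    split_ifs with hi
    · exact ⟨fun _ => hi, fun _ => mul_pos (hKpos _) (hw i)⟩
    · exact ⟨fun h => absurd rfl h.ne, fun h => absurd h hi⟩
  · rcases (zero_le (a := A i l)).eq_or_lt with h0 | hil
    · rw [← h0, zero_mul]; exact zero_le
    by_cases hl : NodeAccess A l q
    swap
    · simp only [y, if_neg hl, mul_zero]; exact zero_le
    have hi : NodeAccess A i q := (NodeAccess.of_pos hil).trans hl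
    simp only [y, if_pos hl, Pi.smul_apply, if_pos hi, smul_eq_mul]
    by_cases hli : NodeAccess A l i
    · have hcl : l ∈ nodeClass A i := ⟨.of_pos hil, hli⟩
      have h1 : A i l * w l ≤ c * w i := by
        rw [hwU i l hcl]
        exact ((mul_le_mulVec A _ i l).trans_eq (hU _ i (self_mem_nodeClass i))).trans
          (mul_le_mul_left (hle i hi) _)
      calc A i l * (K ^ height A l * w l) = K ^ height A l * (A i l * w l) := by ring
        _ ≤ K ^ height A i * (c * w i) :=
          mul_le_mul' (pow_le_pow_right₀ hK1 (height_le (.of_pos hil))) h1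
        _ = _ := by ring
    · have hlt : height A l + 1 ≤ height A i := by
        by_contra h
        exact hli (nodeAccess_of_height_le (.of_pos hil) (by omega))
      calc A i l * (K ^ height A l * w l) = K ^ height A l * (A i l * w l) := by ring
        _ ≤ K ^ height A l * (K * (c * w i)) := mul_le_mul_right (hK i l) _
        _ = K ^ (height A l + 1) * (c * w i) := by ring
        _ ≤ K ^ height A i * (c * w i) := mul_le_mul_left (pow_le_pow_right₀ hK1 hlt) _
        _ = _ := by ring
  · rw [Pi.smul_apply, smul_eq_mul, ← hUpos ⟨nodeClass A q, nodeClass_mem_classes q⟩ i]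
    refine ⟨fun h => pos_iff_ne_zero.2 fun h0 => ?_, mul_pos (hKpos _)⟩
    rw [h0, mul_zero] at h
    exact absurd rfl h.ne
  · by_cases hi : i ∈ nodeClass A q
    · simp only [y, if_pos hi.2, Pi.smul_apply, smul_eq_mul, hwU q i hi]
      exact mul_le_mul_left (pow_le_pow_right₀ hK1 (height_le hi.2)) _
    · have : U ⟨nodeClass A q, nodeClass_mem_classes q⟩ i = 0 := by
        by_contra h0
        exact hi ((hUpos _ i).1 (pos_iff_ne_zero.2 h0))
      rw [Pi.smul_apply, this, smul_zero]
      exact zero_le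
  · rw [Matrix.mulVec_smul, Pi.smul_apply, Pi.smul_apply, hU _ i hi, smul_eq_mul, smul_eq_mul]
    ring

/-- For an initial class, the class vector itself works, even with root zero. Otherwise iterate down
from the supersolution on the predecessors. -/
theorem exists_eigenvector_of_isSpectral {q : ι} (hq : IsSpectral A (nodeClass A q)) :
    ∃ v : ι → MaxAlg, 0 < v q ∧ (∀ i, 0 < v i → NodeAccess A i q) ∧
      A.mulVec v = perronRoot A (nodeClass A q) • v := by
  rcases isSpectral_nodeClass_iff.1 hq with hinit | ⟨hpos, hle⟩
  · obtain ⟨u, hu, h⟩ := exists_class_vector A q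
    refine ⟨u, (hu q).2 (self_mem_nodeClass q), fun i hi => ((hu i).1 hi).2, funext fun i => ?_⟩
    by_cases hi : i ∈ nodeClass A q
    · exact h i hi
    · have hui : u i = 0 := by
        by_contra h0
        exact hi ((hu i).1 (pos_iff_ne_zero.2 h0))
      rw [Pi.smul_apply, hui, smul_zero]
      by_contra h0
      obtain ⟨l, hil, hl⟩ := mulVec_pos_iff.1 (pos_iff_ne_zero.2 h0)
      have hiq : NodeAccess A i q := (NodeAccess.of_pos hil).trans ((hu l).1 hl).2
      exact hi ⟨hinit i hiq, hiq⟩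
  · obtain ⟨y, hy, hAy, u, hu, huy, hAu⟩ := exists_supersolution hpos hle
    set c := perronRoot A (nodeClass A q)
    have hc : c ≠ 0 := hpos.ne'
    obtain ⟨x, hlim, hx⟩ := exists_tendsto_of_mulVec_le A hc hAy
    have hmem : x ∈ supported {i | NodeAccess A i q} := by
      refine (isClosed_supported _).mem_of_tendsto hlim (Eventually.of_forall fun k => ?_)
      induction k with
      | zero =>
        intro i hi
        by_contra h0
        exact hi ((hy i).1 (pos_iff_ne_zero.2 h0))
      | succ k ih =>
        rw [Function.iterate_succ_apply']
        refine Submodule.smul_mem _ _ fun i hi => ?_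
        by_contra h0
        obtain ⟨l, hil, hl⟩ := mulVec_pos_iff.1 (pos_iff_ne_zero.2 h0)
        exact hi ((NodeAccess.of_pos hil).trans (mem_of_mem_supported ih hl))
    -- The class vector of `q` is a barrier from below that keeps the limit positive at `q`.
    have hge : ∀ k, u ≤ (fun w => c⁻¹ • A.mulVec w)^[k] y := by
      intro k
      induction k with
      | zero => exact huy
      | succ k ih =>
        rw [Function.iterate_succ_apply']
        intro i
        by_cases hi : i ∈ nodeClass A q
        · calc u i = c⁻¹ * A.mulVec u i := by rw [hAu i hi, inv_mul_cancel_left₀ hc]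
            _ ≤ _ := mul_le_mul_right (mulVec_mono A ih i) _
        · have hui : u i = 0 := by
            by_contra h0
            exact hi ((hu i).1 (pos_iff_ne_zero.2 h0))
          rw [hui]
          exact zero_le
    have hux : u ≤ x := ge_of_tendsto' hlim hge
    exact ⟨x, ((hu q).2 (self_mem_nodeClass q)).trans_le (hux q),
      fun i hi => mem_of_mem_supported hmem hi, hx⟩

/-- A spectral class of one matrix of a commuting family gives a common eigenvector. -/
theorem exists_common_eigenvector_of_isSpectral {κ : Type*} [Finite κ] {A : κ → Matrix ι ι MaxAlg}
    (hcomm : ∀ i j, A i * A j = A j * A i) {k₀ : κ}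
    (hdist : Set.InjOn (perronRoot (A k₀)) (classes (A k₀)))
    (hC : ∀ k, NodeAccess (A k) = NodeAccess (A k₀)) {q : ι}
    (hq : IsSpectral (A k₀) (nodeClass (A k₀) q)) :
    ∃ v : ι → MaxAlg, v ≠ 0 ∧ ∀ k, (A k).mulVec v = perronRoot (A k) (nodeClass (A k₀) q) • v ∧
      ∃ i ∈ nodeClass (A k₀) q, 0 < v i ∧ ∀ j, 0 < v j → NodeAccess (A k₀) j q := by
  obtain ⟨v₀, hv₀q, hv₀, hv₀c⟩ := exists_eigenvector_of_isSpectral hq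
  obtain ⟨v, ⟨hvc, hvs⟩, hv0, hv⟩ := exists_common_eigenvector
    (eigenspace (A k₀) (perronRoot (A k₀) (nodeClass (A k₀) q)) ⊓
      supported {i | NodeAccess (A k₀) i q}) A hcomm
    ((Submodule.ne_bot_iff _).2 ⟨v₀, ⟨hv₀c, fun i hi => by
      by_contra h0
      exact hi (hv₀ i (pos_iff_ne_zero.2 h0))⟩, fun h0 => hv₀q.ne' (congrFun h0 q)⟩)
    ((isClosed_eigenspace _ _).inter (isClosed_supported _))
    (fun k v hv => ⟨mulVec_mem_eigenspace (hcomm k₀ k) hv.1, fun i hi => by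
      by_contra h0
      obtain ⟨l, hil, hl⟩ := mulVec_pos_iff.1 (pos_iff_ne_zero.2 h0)
      have hil : NodeAccess (A k₀) i l := hC k ▸ NodeAccess.of_pos hil
      exact hi (hil.trans (mem_of_mem_supported hv.2 hl))⟩)
  -- The common eigenvector might vanish at the class of `q`; but its final class has the root of
  -- that class, hence coincides with it.
  obtain ⟨m, hm, hms⟩ := exists_final_node hdist hv0 hvc
  have hmq := (isSpectral_of_eigenvector hvc ⟨m, self_mem_nodeClass m, hm⟩ hms).1
  have hmem : m ∈ nodeClass (A k₀) q :=
    (hdist (nodeClass_mem_classes m) (nodeClass_mem_classes q) hmq) ▸ self_mem_nodeClass m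
  have hsupp : ∀ j, 0 < v j → NodeAccess (A k₀) j q := fun j hj => (hms j hj).trans hmem.2
  refine ⟨v, hv0, fun k => ⟨?_, m, hmem, hm, hsupp⟩⟩
  obtain ⟨c, hc⟩ := hv k
  have hcl := nodeClass_congr (hC k) q
  rw [← hcl, (isSpectral_of_eigenvector hc (q := q) ⟨m, hcl ▸ hmem, hm⟩
    fun j hj => hC k ▸ hsupp j hj).1, hc]

end Spectral

section

/-! ### Transfer along equal access relations. -/

section AccessCongr

variable {ι : Type*} {A B : Matrix ι ι MaxAlg}

theorem NodeAccess.of_edges (h : ∀ i j, 0 < B i j → NodeAccess A i j) {i j : ι}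
    (hij : NodeAccess B i j) : NodeAccess A i j := by
  induction hij with
  | refl => exact .refl
  | tail _ hbc ih => exact ih.trans (h _ _ hbc)

theorem nodeAccess_eq_of_edges (h : ∀ i j, 0 < A i j → NodeAccess B i j)
    (h' : ∀ i j, 0 < B i j → NodeAccess A i j) : NodeAccess A = NodeAccess B :=
  funext fun _ => funext fun _ => propext ⟨.of_edges h, .of_edges h'⟩

theorem classes_congr (h : NodeAccess A = NodeAccess B) : classes A = classes B := by
  simp only [classes, h]

theorem access_congr (h : NodeAccess A = NodeAccess B) {μ ν : Set ι} :
    Access A μ ν ↔ Access B μ ν := by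
  simp only [access_iff, nodeClass_congr h, h]

theorem nodeAccess_sum_eq {κ : Type*} [Fintype κ] {A : κ → Matrix ι ι MaxAlg}
    (hA : ∀ k l, NodeAccess (A k) = NodeAccess (A l)) (k : κ) :
    NodeAccess (∑ l, A l) = NodeAccess (A k) := by
  refine nodeAccess_eq_of_edges (fun i j h => ?_) fun i j h => .of_pos ?_
  · rw [Matrix.sum_apply, sum_pos_iff] at h
    obtain ⟨l, -, hl⟩ := h
    exact hA l k ▸ NodeAccess.of_pos hl
  · rw [Matrix.sum_apply, sum_pos_iff]
    exact ⟨k, Finset.mem_univ k, h⟩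

end AccessCongr

variable {ι : Type*} [Fintype ι]

/-- If the classes of `A` have distinct Perron roots, then the eigenvalues of `A` are the Perron
roots of its spectral classes. -/
theorem eigenvalues_eq_image {A : Matrix ι ι MaxAlg}
    (hdist : Set.InjOn (perronRoot A) (classes A)) :
    eigenvalues A = perronRoot A '' {μ | IsSpectral A μ} := by
  ext c
  constructor
  · rintro ⟨v, hv0, hv⟩
    obtain ⟨q, hq, hs⟩ := exists_final_node hdist hv0 hv
    obtain ⟨h1, h2⟩ := isSpectral_of_eigenvector hv ⟨q, self_mem_nodeClass q, hq⟩ hs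
    exact ⟨_, h2, h1⟩
  · rintro ⟨μ, hμ, rfl⟩
    obtain ⟨q, rfl⟩ := hμ.1
    obtain ⟨v, hvq, -, hv⟩ := exists_eigenvector_of_isSpectral hμ
    exact ⟨v, fun h0 => hvq.ne' (congrFun h0 q), hv⟩

/-! ### Max polynomials acting on a common eigenvector. -/

section Eval

variable {v : ι → MaxAlg}

theorem sum_mulVec_eq {κ : Type*} {s : Finset κ} {A : κ → Matrix ι ι MaxAlg} {c : κ → MaxAlg}
    (h : ∀ k ∈ s, (A k).mulVec v = c k • v) :
    (∑ k ∈ s, A k).mulVec v = (∑ k ∈ s, c k) • v := by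
  rw [Matrix.sum_mulVec, Finset.sum_smul]
  exact Finset.sum_congr rfl h

variable [DecidableEq ι]

theorem pow_mulVec_eq {A : Matrix ι ι MaxAlg} {c : MaxAlg} (h : A.mulVec v = c • v) (k : ℕ) :
    (A ^ k).mulVec v = c ^ k • v := by
  induction k with
  | zero => simp
  | succ k ih =>
    rw [pow_succ, ← Matrix.mulVec_mulVec, h, Matrix.mulVec_smul, ih, smul_smul, pow_succ, mul_comm]

theorem prod_ofFn_mulVec_eq {m : ℕ} {A : Fin m → Matrix ι ι MaxAlg} {c : Fin m → MaxAlg}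
    (h : ∀ k, (A k).mulVec v = c k • v) :
    (List.ofFn A).prod.mulVec v = (∏ k, c k) • v := by
  induction m with
  | zero => simp
  | succ m ih =>
    rw [List.ofFn_succ, List.prod_cons, ← Matrix.mulVec_mulVec, ih fun k => h k.succ,
      Matrix.mulVec_smul, h, smul_smul, Fin.prod_univ_succ, mul_comm]

variable {r : ℕ} (p : MvPolynomial (Fin r) MaxAlg) {A : Fin r → Matrix ι ι MaxAlg}

theorem evalMatrix_mulVec_eq {c : Fin r → MaxAlg} (h : ∀ k, (A k).mulVec v = c k • v) :
    (evalMatrix p A).mulVec v = MvPolynomial.eval c p • v := by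
  rw [evalMatrix, MvPolynomial.eval_eq']
  refine sum_mulVec_eq fun d _ => ?_
  rw [Matrix.smul_mulVec, prod_ofFn_mulVec_eq fun k => pow_mulVec_eq (h k) (d k), smul_smul]

theorem commute_evalMatrix (hcomm : ∀ i j, A i * A j = A j * A i) (k : Fin r) :
    evalMatrix p A * A k = A k * evalMatrix p A := by
  have h : Commute (A k) (evalMatrix p A) := by
    refine Commute.sum_right _ _ _ fun d _ => Commute.smul_right (Commute.list_prod_right _ _ ?_) _
    intro B hB
    obtain ⟨l, rfl⟩ := (List.mem_ofFn' _ _).1 hB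
    exact (show Commute (A k) (A l) from hcomm k l).pow_right _
  exact h.eq.symm

end Eval

theorem nodeAccess_eq {κ : Type*} {A : κ → Matrix ι ι MaxAlg}
    (hcomm : ∀ i j, A i * A j = A j * A i)
    (hdist : ∀ i, Set.InjOn (perronRoot (A i)) (classes (A i))) (k l : κ) : NodeAccess (A k) = NodeAccess (A l) :=
  nodeAccess_eq_of_edges (fun _ _ => nodeAccess_of_commute (hdist l) (hcomm l k))
    fun _ _ => nodeAccess_of_commute (hdist k) (hcomm k l)

/-! ### Spectral classes of the family and of its sum. -/

section Family

variable {κ : Type*} [Fintype κ] {A : κ → Matrix ι ι MaxAlg}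

/-- The common class vector is an eigenvector of the block of the sum, for the sum of the roots. -/
theorem perronRoot_sum (hcomm : ∀ i j, A i * A j = A j * A i)
    (hA : ∀ k l, NodeAccess (A k) = NodeAccess (A l)) (k₀ : κ) (q : ι) :
    perronRoot (∑ k, A k) (nodeClass (A k₀) q) = ∑ k, perronRoot (A k) (nodeClass (A k₀) q) := by
  have : Nonempty κ := ⟨k₀⟩
  obtain ⟨u, hu, h⟩ := exists_common_class_vector A hcomm (A k₀) (fun k => hA k k₀) q
  rw [← nodeClass_congr (nodeAccess_sum_eq hA k₀) q] at *
  refine (pos_and_perronRoot_eq (z := u) (fun i => (hu i).1)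
    (fun h0 => ((hu q).2 (self_mem_nodeClass q)).ne' (congrFun h0 q)) fun i hi => ?_).2
  rw [Matrix.sum_mulVec, Finset.sum_apply, Finset.sum_mul]
  exact Finset.sum_congr rfl fun k _ => h k i hi

theorem isSpectral_congr (hcomm : ∀ i j, A i * A j = A j * A i)
    (hdist : ∀ i, Set.InjOn (perronRoot (A i)) (classes (A i))) (k l : κ) {μ : Set ι} (h : IsSpectral (A k) μ) :
    IsSpectral (A l) μ := by
  have hA := nodeAccess_eq hcomm hdist
  obtain ⟨q, rfl⟩ := h.1
  obtain ⟨v, -, hv⟩ := exists_common_eigenvector_of_isSpectral hcomm (hdist k) (fun m => hA m k) h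
  obtain ⟨hl, i, hi, hvi, hs⟩ := hv l
  change IsSpectral (A l) (nodeClass (A k) q)
  rw [nodeClass_congr (hA k l)] at *
  rw [hA k l] at hs
  exact (isSpectral_of_eigenvector hl ⟨i, hi, hvi⟩ hs).2

theorem isSpectral_iff_isSpectral_sum (hcomm : ∀ i j, A i * A j = A j * A i)
    (hdist : ∀ i, Set.InjOn (perronRoot (A i)) (classes (A i))) (k : κ) {μ : Set ι} :
    IsSpectral (A k) μ ↔ IsSpectral (∑ l, A l) μ := by
  have hA := nodeAccess_eq hcomm hdist
  have hS := nodeAccess_sum_eq hA k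
  constructor
  · intro h
    obtain ⟨q, rfl⟩ := h.1
    obtain ⟨v, -, hv⟩ :=
      exists_common_eigenvector_of_isSpectral hcomm (hdist k) (fun m => hA m k) h
    obtain ⟨-, i, hi, hvi, hs⟩ := hv k
    have hSv := sum_mulVec_eq fun l (_ : l ∈ Finset.univ) => (hv l).1
    change IsSpectral (∑ l, A l) (nodeClass (A k) q)
    rw [← nodeClass_congr hS] at *
    rw [← hS] at hs
    exact (isSpectral_of_eigenvector hSv ⟨i, hi, hvi⟩ hs).2
  · intro h
    obtain ⟨q, rfl⟩ := h.1
    change IsSpectral (∑ l, A l) (nodeClass (∑ l, A l) q) at h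
    change IsSpectral (A k) (nodeClass (∑ l, A l) q)
    -- The root of the sum on this class is attained by some `A m`. On every class the root of `A m`
    -- is at most that of the sum, so the class is spectral for `A m`, hence for `A k`.
    obtain ⟨m, -, hm⟩ := exists_sum_eq ⟨k, Finset.mem_univ k⟩
      fun l => perronRoot (A l) (nodeClass (A k) q)
    rw [← perronRoot_sum hcomm hA k q] at hm
    refine isSpectral_congr hcomm hdist m k ?_
    rw [nodeClass_congr (hS.trans (hA k m))]
    rw [isSpectral_nodeClass_iff] at h ⊢
    rw [hS] at h
    rw [hA m k]
    refine h.imp id fun ⟨hpos, hle⟩ => ?_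
    rw [nodeClass_congr hS, hm, nodeClass_congr (hA k m)] at hpos
    refine ⟨hpos, fun i hi => ?_⟩
    have h1 := hle i hi
    rw [nodeClass_congr hS, nodeClass_congr hS, hm, perronRoot_sum hcomm hA k i,
      nodeClass_congr (hA k m), nodeClass_congr (hA k m)] at h1
    exact (le_sum (fun l => perronRoot (A l) (nodeClass (A m) i)) (Finset.mem_univ m)).trans h1

end Family

theorem eigenvalues_evalMatrix [DecidableEq ι] {r : ℕ} (k₀ : Fin r)
    {A : Fin r → Matrix ι ι MaxAlg} (hcomm : ∀ i j, A i * A j = A j * A i)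
    (hdist : ∀ i, Set.InjOn (perronRoot (A i)) (classes (A i)))
    (p : MvPolynomial (Fin r) MaxAlg) :
    eigenvalues (evalMatrix p A) =
      (fun μ => MvPolynomial.eval (fun i => perronRoot (A i) μ) p) ''
        {μ | ∀ i, IsSpectral (A i) μ} := by
  have hA := nodeAccess_eq hcomm hdist
  ext c
  constructor
  · rintro ⟨w, hw0, hw⟩
    -- The polynomial commutes with every `A k`, so its eigenspace is invariant; the given `w` can
    -- be replaced by a common eigenvector.
    obtain ⟨v, hvP, hv0, hv⟩ := exists_common_eigenvector (eigenspace (evalMatrix p A) c) A hcomm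
      ((Submodule.ne_bot_iff _).2 ⟨w, hw, hw0⟩) (isClosed_eigenspace _ _)
      (fun k v hv => mulVec_mem_eigenspace (commute_evalMatrix p hcomm k) hv)
    choose b hb using hv
    obtain ⟨q, hq, hs⟩ := exists_final_node (hdist k₀) hv0 (hb k₀)
    have hspec : ∀ k, perronRoot (A k) (nodeClass (A k₀) q) = b k ∧
        IsSpectral (A k) (nodeClass (A k₀) q) := by
      intro k
      rw [← nodeClass_congr (hA k k₀)]
      exact isSpectral_of_eigenvector (hb k) ⟨q, self_mem_nodeClass q, hq⟩
        fun i hi => hA k k₀ ▸ hs i hi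
    refine ⟨nodeClass (A k₀) q, fun k => (hspec k).2, ?_⟩
    have h1 : (evalMatrix p A).mulVec v = c • v := hvP
    rw [evalMatrix_mulVec_eq p hb] at h1
    simp only [fun k => (hspec k).1]
    exact mul_right_cancel₀ hq.ne' (congrFun h1 q)
  · rintro ⟨μ, hμ, rfl⟩
    obtain ⟨q, rfl⟩ := (hμ k₀).1
    obtain ⟨v, hv0, hv⟩ := exists_common_eigenvector_of_isSpectral hcomm (hdist k₀)
      (fun m => hA m k₀) (hμ k₀)
    exact ⟨v, hv0, evalMatrix_mulVec_eq p fun k => (hv k).1⟩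

end

end

end MaxAlg

theorem theoremt (n r : ℕ) (hr : 1 ≤ r) (A : Fin r → Matrix (Fin n) (Fin n) MaxAlg)
    (hcomm : ∀ i j, A i * A j = A j * A i)
    (hdist : ∀ i, Set.InjOn (MaxAlg.perronRoot (A i)) (MaxAlg.classes (A i))) :
    (∀ i, MaxAlg.classes (A i) = MaxAlg.classes (∑ k, A k)) ∧
    (∀ i μ ν, MaxAlg.Access (A i) μ ν ↔ MaxAlg.Access (∑ k, A k) μ ν) ∧
    ((∀ i μ, MaxAlg.IsSpectral (A i) μ ↔ MaxAlg.IsSpectral (∑ k, A k) μ) ∧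
      (∀ i, (MaxAlg.eigenvalues (A i)).Finite) ∧
      ∀ i j, (MaxAlg.eigenvalues (A i)).ncard = (MaxAlg.eigenvalues (A j)).ncard) ∧
    ∀ p : MvPolynomial (Fin r) MaxAlg,
      MaxAlg.eigenvalues (MaxAlg.evalMatrix p A) =
        (fun μ : Set (Fin n) => MvPolynomial.eval (fun i => MaxAlg.perronRoot (A i) μ) p) ''
          {μ | ∀ i, MaxAlg.IsSpectral (A i) μ} := by
  have hS := fun i => (MaxAlg.nodeAccess_sum_eq (MaxAlg.nodeAccess_eq hcomm hdist) i).symm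
  refine ⟨fun i => MaxAlg.classes_congr (hS i), fun i _ _ => MaxAlg.access_congr (hS i),
    ⟨fun i _ => MaxAlg.isSpectral_iff_isSpectral_sum hcomm hdist i, fun i => ?_, fun i j => ?_⟩,
    MaxAlg.eigenvalues_evalMatrix ⟨0, hr⟩ hcomm hdist⟩
  · rw [MaxAlg.eigenvalues_eq_image (hdist i)]
    exact (Set.toFinite _).image _
  -- Roots are injective on classes, so both sides count the common spectral classes.
  · have hspec : {μ | MaxAlg.IsSpectral (A i) μ} = {μ | MaxAlg.IsSpectral (A j) μ} :=
      Set.ext fun μ => ⟨MaxAlg.isSpectral_congr hcomm hdist i j,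
        MaxAlg.isSpectral_congr hcomm hdist j i⟩
    rw [MaxAlg.eigenvalues_eq_image (hdist i), MaxAlg.eigenvalues_eq_image (hdist j),
      Set.InjOn.ncard_image ((hdist i).mono fun _ h => h.1),
      Set.InjOn.ncard_image ((hdist j).mono fun _ h => h.1), hspec]
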